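/- **Theorem (the 2-variation operator is unbounded on $L^2$).** For a sequence $(a_N)_{N\ge 1}$ of complex numbers let $$\mathcal V^2(a_N) := \sup_{N_1<N_2<\cdots}\Big(\sum_{k\ge1}|a_{N_k}-a_{N_{k+1}}|^2\Big)^{1/2}\in[0,\infty],$$ the supremum being over all strictly increasing sequences of positive integers. (i) (Torus rotations.) Let $\mathbb T=\mathbb R/\mathbb Z$ with Lebesgue measure, and for $\alpha\in\mathbb T$ and $f:\mathbb T\to\mathbb C$ put $K_N^\alpha f(x):=\frac1N\sum_{n=1}^N f(x+n^2\alpha)$. For every $C>0$ and every sufficiently large integer $R\ge R_0(C)$ there is, with $\alpha=2^{-R}$, an $f\in L^2(\mathbb T)$ with $\|f\|_{L^2(\mathbb T)}=1$ and $$\|\mathcal V^2(K_N^{\alpha}f)\|_{L^2(\mathbb T)}\ge C.$$ (ii) (Aperiodic systems.) Let $(X,\Sigma,\mu)$ be a probability space and $\tau:X\to X$ an invertible bi-measurable measure-preserving transformation that is aperiodic: for every $n\ge1$, every $E\in\Sigma$ with $\mu(E)>0$ contains some $F\in\Sigma$ with $\mu(F\,\triangle\,\tau^{-n}F)>0$.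 (On a standard Borel space this says that $\mu$-almost no point is periodic under $\tau$.) Put $M_Nf(x):=\frac1N\sum_{n=1}^N \tau^{n^2}f(x)$, where $\tau^{m}f(x):=f(\tau^{-m}x)$. Then for every $C>0$ there is an $f\in L^2(X,\mu)$ with $\|f\|_{L^2(X)}=1$ and $$\|\mathcal V^2(M_Nf)\|_{L^2(X)}\ge C.$$ -/

import Mathlib

open MeasureTheory
open scoped ENNReal symmDiff

/-- The `r`-variation of a sequence indexed by the positive integers: the supremum, over all
strictly increasing sequences of indices, of the `ℓ^r`-norm of the successive differences.
It takes values in `[0, ∞]`. -/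
noncomputable def rVariation (r : ℝ) (a : ℕ+ → ℂ) : ℝ≥0∞ :=
  ⨆ (i : ℕ → ℕ+) (_ : StrictMono i), (∑' k, ‖a (i k) - a (i (k + 1))‖ₑ ^ r) ^ (1 / r)

/-- The average of `f` along the first `N` squares of the orbit of `x` under `S`:
`(1 / N) ∑_{1 ≤ n ≤ N} f (S^{n²} x)`. -/
noncomputable def squareMean {X : Type*} (S : X → X) (f : X → ℂ) (N : ℕ+) (x : X) : ℂ :=
  (1 / ((N : ℕ) : ℂ)) * ∑ n ∈ Finset.Icc 1 (N : ℕ), f (S^[n ^ 2] x)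

/-- Aperiodicity of a measure-preserving transformation of an arbitrary measure space: no positive
power `T^n` fixes, up to null sets, all measurable subsets of a measurable set of positive measure.
On spaces whose measurable sets are countably separated (in particular on standard Borel spaces)
this says that almost no point is periodic, see `isAperiodic_iff_ae_not_periodic`. -/
def IsAperiodic {X : Type*} [MeasurableSpace X] (T : X → X) (μ : Measure X) : Prop :=
  ∀ n : ℕ, 0 < n → ∀ E : Set X, MeasurableSet E → μ E ≠ 0 →
    ∃ F ⊆ E, MeasurableSet F ∧ μ (F ∆ (T^[n] ⁻¹' F)) ≠ 0

theorem isAperiodic_iff_ae_not_periodic {X : Type*} [MeasurableSpace X]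
    [MeasurableSpace.CountablySeparated X] (μ : Measure X) (T : X ≃ᵐ X) :
    IsAperiodic T μ ↔ ∀ n : ℕ, 0 < n → μ {x | T^[n] x = x} = 0 := by
  have hT : ∀ n, Measurable (T^[n]) := fun n => T.measurable.iterate n
  constructor
  · intro h n hn
    by_contra hE
    obtain ⟨g, hg, hginj⟩ := MeasurableSpace.measurable_injection_nat_bool_of_countablySeparated X
    have hm : MeasurableSet {x | T^[n] x = x} := by
      have : {x | T^[n] x = x} = ⋂ k, {x | g (T^[n] x) k = g x k} := by
        ext x
        simp only [Set.mem_ofPred_eq, Set.mem_iInter, ← funext_iff, hginj.eq_iff]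
      rw [this]
      exact MeasurableSet.iInter fun k => measurableSet_eq_fun
        ((measurable_pi_apply k).comp (hg.comp (hT n))) ((measurable_pi_apply k).comp hg)
    obtain ⟨F, hFE, -, hF⟩ := h n hn _ hm hE
    apply hF
    have : F = T^[n] ⁻¹' F := by
      ext x
      constructor
      · intro hx
        have : T^[n] x = x := hFE hx
        simpa [this] using hx
      · intro hx
        have h1 : T^[n] (T^[n] x) = T^[n] x := hFE hx
        have h2 : T^[n] x = x := (T.injective.iterate n) h1
        simpa [h2] using hx
    rw [← this]
    simp
  · intro h n hn E hE hE0
    by_contra! hcon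
    obtain ⟨S, hS, hSm, hsep⟩ := (MeasurableSpace.CountablySeparated.countably_separated (α := X)).1
    have key : ∀ F ⊆ E, MeasurableSet F → ∀ᵐ x ∂μ, x ∈ F ↔ T^[n] x ∈ F := by
      intro F hF hFm
      filter_upwards [measure_eq_zero_iff_ae_notMem.1 (hcon F hF hFm)] with x hx
      simp only [Set.mem_symmDiff, Set.mem_preimage] at hx
      tauto
    have h1 : ∀ᵐ x ∂μ, ∀ A ∈ S, x ∈ E ∩ A ↔ T^[n] x ∈ E ∩ A := by
      rw [ae_ball_iff hS]
      exact fun A hA => key _ Set.inter_subset_left (hE.inter (hSm A hA))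
    apply hE0
    rw [measure_eq_zero_iff_ae_notMem]
    filter_upwards [h1, key E le_rfl hE, measure_eq_zero_iff_ae_notMem.1 (h n hn)]
      with x hx1 hx2 hx3 hxE
    apply hx3
    have hTE := hx2.1 hxE
    refine (hsep x trivial (T^[n] x) trivial fun A hA => ?_).symm
    have := hx1 A hA
    simp only [Set.mem_inter_iff, hxE, hTE, true_and] at this
    exact this

/-!
The function is, on a long block of an orbit, a sum of `K = m ^ n` square waves with widely
separated periods. The average of a square wave of half-period `M` over the first `N` squares is
small once `N` is much larger than `√M`, because the number of `n` with `⌊(x + n ^ 2) / M⌋ = i` is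
almost decreasing in `i`, so that the alternating sum of these numbers is bounded by their size at
the start. It is almost the value at the starting point as long as `N` is much smaller than `√M`.
Along a suitable sequence of times the averages therefore drop the waves one at a time, and they
follow a simple random walk with `K` steps, whose signs are the parities of digits of the
starting point.

The mean of the square of the `2`-variation of this walk is not `O(K)`. Divide the steps into `m`
blocks, recursively. With a probability bounded below in terms of `m`, every block has an increment
at least of the order of its standard deviation while its own variation is not large; the square of
the total increment then beats the sum of the contributions of the blocks by a definite proportion
of the variance. Hence each of the `n` levels of the subdivision adds a fixed amount to the ratio of
the mean variation to `K`, while this ratio stays below a given bound.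

Small arcs around the multiples of `α`, and the disjoint preimages of a set of positive measure in
an aperiodic system, form towers along which such a block can be copied.
-/

open Finset
open scoped BigOperators NNReal

/-- A lower bound for the square of the `2`-variation of `a` on `[s, s + m ^ n]`: at each level of
the `m`-adic subdivision one takes the better of the subdivided block and the whole increment. -/
noncomputable def blockVar {E : Type*} [NormedAddCommGroup E] (m : ℕ) :
    ℕ → (ℕ → E) → ℕ → ℝ
  | 0, a, s => ‖a s - a (s + 1)‖ ^ 2
  | n + 1, a, s => max (∑ i ∈ range m, blockVar m n a (s + m ^ n * i))
      (‖a s - a (s + m ^ (n + 1))‖ ^ 2)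

/-- `IsChainSum a s t v` means that `v` is the sum of the squares of the increments of `a` along
some chain of indices which increases strictly from `s` to `t`. -/
inductive IsChainSum {E : Type*} [NormedAddCommGroup E] (a : ℕ → E) : ℕ → ℕ → ℝ → Prop
  | refl (s : ℕ) : IsChainSum a s s 0
  | cons {s t u : ℕ} {v : ℝ} : s < t → IsChainSum a t u v →
      IsChainSum a s u (‖a s - a t‖ ^ 2 + v)

section BlockVar

variable {E E' : Type*} [NormedAddCommGroup E] [NormedAddCommGroup E']

theorem blockVar_nonneg (m n : ℕ) (a : ℕ → E) (s : ℕ) : 0 ≤ blockVar m n a s := by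
  cases n with
  | zero => exact sq_nonneg _
  | succ n => exact (sq_nonneg _).trans (le_max_right _ _)

theorem blockVar_le_add {m : ℕ} (hm : 0 < m) {δ : ℝ} (hδ : 0 ≤ δ) (n : ℕ) {a : ℕ → E}
    {b : ℕ → E'} {s t : ℕ} (h : ∀ i ≤ m ^ n, ∀ j ≤ m ^ n,
      ‖a (s + i) - a (s + j)‖ ^ 2 ≤ ‖b (t + i) - b (t + j)‖ ^ 2 + δ) :
    blockVar m n a s ≤ blockVar m n b t + m ^ n * δ := by
  induction n generalizing s t with
  | zero => simpa [blockVar] using h 0 (by simp) 1 (by simp)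
  | succ n ih =>
    have hblock : ∀ i ∈ range m,
        blockVar m n a (s + m ^ n * i) ≤ blockVar m n b (t + m ^ n * i) + m ^ n * δ := by
      intro i hi
      have hle : m ^ n * i + m ^ n ≤ m ^ (n + 1) := by
        rw [pow_succ, ← Nat.mul_succ]
        exact Nat.mul_le_mul_left _ (mem_range.1 hi)
      refine ih fun p hp q hq => ?_
      simpa only [add_assoc] using h (m ^ n * i + p) (by lia) (m ^ n * i + q) (by lia)
    refine max_le ?_ ?_
    · calc ∑ i ∈ range m, blockVar m n a (s + m ^ n * i)
          ≤ ∑ i ∈ range m, (blockVar m n b (t + m ^ n * i) + m ^ n * δ) := sum_le_sum hblock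
        _ = ∑ i ∈ range m, blockVar m n b (t + m ^ n * i) + m ^ (n + 1) * δ := by
            rw [sum_add_distrib, sum_const, card_range, nsmul_eq_mul, pow_succ', mul_assoc]
        _ ≤ _ := add_le_add_left (le_max_left _ _) _
    · have hmδ : δ ≤ m ^ (n + 1) * δ :=
        le_mul_of_one_le_left hδ (one_le_pow₀ (by exact_mod_cast hm))
      exact (h 0 (by simp) (m ^ (n + 1)) le_rfl).trans (add_le_add (le_max_right _ _) hmδ)

theorem blockVar_congr {m : ℕ} (hm : 0 < m) (n : ℕ) {a : ℕ → E} {b : ℕ → E'} {s t : ℕ}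
    (h : ∀ i ≤ m ^ n, ∀ j ≤ m ^ n, ‖a (s + i) - a (s + j)‖ = ‖b (t + i) - b (t + j)‖) :
    blockVar m n a s = blockVar m n b t := by
  apply le_antisymm
  · simpa using blockVar_le_add hm le_rfl n fun i hi j hj => by rw [h i hi j hj, add_zero]
  · simpa using blockVar_le_add hm le_rfl n fun i hi j hj => by rw [← h i hi j hj, add_zero]

theorem IsChainSum.of_lt (a : ℕ → E) {s t : ℕ} (h : s < t) :
    IsChainSum a s t (‖a s - a t‖ ^ 2) := by
  simpa using cons h (refl t)

theorem IsChainSum.trans {a : ℕ → E} {s t u : ℕ} {v w : ℝ} (h₁ : IsChainSum a s t v)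
    (h₂ : IsChainSum a t u w) : IsChainSum a s u (v + w) := by
  induction h₁ with
  | refl => simpa using h₂
  | cons hst _ ih => simpa only [add_assoc] using cons hst (ih h₂)

theorem IsChainSum.exists_strictMono {a : ℕ → E} {s t : ℕ} {v : ℝ} (h : IsChainSum a s t v) :
    ∃ (L : ℕ) (i : ℕ → ℕ), StrictMono i ∧ i 0 = s ∧
      v = ∑ k ∈ range L, ‖a (i k) - a (i (k + 1))‖ ^ 2 := by
  induction h with
  | refl s => exact ⟨0, (s + ·), fun _ _ h => Nat.add_lt_add_left h s, rfl, by simp⟩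
  | @cons s t u v hst _ ih =>
    obtain ⟨L, i, hi, rfl, rfl⟩ := ih
    refine ⟨L + 1, fun k => Nat.casesOn k s i, strictMono_nat_of_lt_succ ?_, rfl, ?_⟩
    · rintro (_ | k)
      exacts [hst, hi k.lt_succ_self]
    · rw [sum_range_succ', add_comm]
      rfl

theorem isChainSum_blockVar {m : ℕ} (hm : 0 < m) (n : ℕ) (a : ℕ → E) (s : ℕ) :
    IsChainSum a s (s + m ^ n) (blockVar m n a s) := by
  induction n generalizing s with
  | zero => simpa [blockVar] using IsChainSum.of_lt a s.lt_succ_self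
  | succ n ih =>
    have hblocks : ∀ q, IsChainSum a s (s + m ^ n * q)
        (∑ i ∈ range q, blockVar m n a (s + m ^ n * i)) := by
      intro q
      induction q with
      | zero => exact IsChainSum.refl s
      | succ q ihq =>
        rw [sum_range_succ, Nat.mul_succ, ← add_assoc]
        exact ihq.trans (ih _)
    rcases max_choice (∑ i ∈ range m, blockVar m n a (s + m ^ n * i))
      (‖a s - a (s + m ^ (n + 1))‖ ^ 2) with h | h <;> rw [blockVar, h]
    · exact hblocks m
    · exact IsChainSum.of_lt a (Nat.lt_add_of_pos_right (pow_pos hm _))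

end BlockVar

theorem ofReal_blockVar_le_rVariation_sq {m : ℕ} (hm : 0 < m) (n : ℕ) (a : ℕ+ → ℂ)
    {N : ℕ → ℕ+} (hN : StrictMono N) (s : ℕ) :
    ENNReal.ofReal (blockVar m n (fun j => a (N j)) s) ≤ rVariation 2 a ^ 2 := by
  obtain ⟨L, i, hi, -, hsum⟩ := (isChainSum_blockVar hm n (fun j => a (N j)) s).exists_strictMono
  have hle : (∑' k, ‖a (N (i k)) - a (N (i (k + 1)))‖ₑ ^ (2 : ℝ)) ^ (1 / 2 : ℝ) ≤
      rVariation 2 a :=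
    le_iSup₂ (f := fun (i : ℕ → ℕ+) (_ : StrictMono i) =>
      (∑' k, ‖a (i k) - a (i (k + 1))‖ₑ ^ (2 : ℝ)) ^ (1 / (2 : ℝ))) (N ∘ i) (hN.comp hi)
  calc ENNReal.ofReal (blockVar m n (fun j => a (N j)) s)
      = ∑ k ∈ range L, ‖a (N (i k)) - a (N (i (k + 1)))‖ₑ ^ (2 : ℝ) := by
        rw [hsum, ENNReal.ofReal_sum_of_nonneg fun _ _ => sq_nonneg _]
        refine sum_congr rfl fun k _ => ?_
        rw [ENNReal.ofReal_pow (norm_nonneg _), ofReal_norm, ENNReal.rpow_two]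
    _ ≤ ∑' k, ‖a (N (i k)) - a (N (i (k + 1)))‖ₑ ^ (2 : ℝ) := ENNReal.sum_le_tsum _
    _ = ((∑' k, ‖a (N (i k)) - a (N (i (k + 1)))‖ₑ ^ (2 : ℝ)) ^ (1 / 2 : ℝ)) ^ 2 := by
        rw [← ENNReal.rpow_two, ← ENNReal.rpow_mul, one_div_mul_cancel two_ne_zero,
          ENNReal.rpow_one]
    _ ≤ rVariation 2 a ^ 2 := by gcongr

section DigitAverages

variable {M : Type*} [AddCommMonoid M] [Module ℚ≥0 M]

theorem expect_range_mul (a b : ℕ) (φ : ℕ → M) :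
    𝔼 x ∈ range (a * b), φ x = 𝔼 i ∈ range a, 𝔼 j ∈ range b, φ (j + b * i) := by
  have hsum : ∑ x ∈ range (a * b), φ x = ∑ i ∈ range a, ∑ j ∈ range b, φ (j + b * i) := by
    induction a with
    | zero => simp
    | succ a ih =>
      rw [Nat.succ_mul, sum_range_add, ih, sum_range_succ]
      simp only [add_comm, mul_comm]
  simp only [expect, card_range, hsum, ← smul_sum, smul_smul, Nat.cast_mul, mul_inv]

theorem expect_range_div {b : ℕ} (hb : 0 < b) (a : ℕ) (g : ℕ → M) :
    𝔼 x ∈ range (a * b), g (x / b) = 𝔼 y ∈ range a, g y := by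
  have hdiv : ∀ i, ∀ j ∈ range b, (j + b * i) / b = i := fun i j hj => by
    rw [Nat.add_mul_div_left _ _ hb, Nat.div_eq_of_lt (mem_range.1 hj), zero_add]
  rw [expect_range_mul]
  refine expect_congr rfl fun i _ => ?_
  rw [expect_congr rfl fun j hj => by rw [hdiv i j hj],
    expect_const (nonempty_range_iff.2 hb.ne')]

theorem expect_range_mod {a : ℕ} (ha : 0 < a) (b : ℕ) (g : ℕ → M) :
    𝔼 x ∈ range (a * b), g (x % b) = 𝔼 y ∈ range b, g y := by
  have hmod : ∀ i, ∀ j ∈ range b, (j + b * i) % b = j := fun i j hj => by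
    rw [Nat.add_mul_mod_self_left, Nat.mod_eq_of_lt (mem_range.1 hj)]
  rw [expect_range_mul, expect_congr rfl fun i _ => expect_congr rfl fun j hj => by
    rw [hmod i j hj], expect_const (nonempty_range_iff.2 ha.ne')]

theorem expect_range_mul_le_mod_add_le {a : ℕ} (ha : 0 < a) (b d : ℕ) :
    𝔼 x ∈ range (a * b), (if b ≤ x % b + d then (1 : ℝ) else 0) ≤ d / b := by
  have hcard : #{y ∈ range b | b ≤ y + d} ≤ d := by
    have hsub : {y ∈ range b | b ≤ y + d} ⊆ Ico (b - d) b := fun y hy => by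
      rw [mem_filter, mem_range] at hy
      exact mem_Ico.2 ⟨by lia, hy.1⟩
    have := card_le_card hsub
    rw [Nat.card_Ico] at this
    lia
  rw [expect_range_mod ha b fun y => if b ≤ y + d then (1 : ℝ) else 0, expect_eq_sum_div_card,
    sum_boole, card_range]
  gcongr

theorem expect_range_pow_digit {b m k : ℕ} (hb : 0 < b) (hk : k < m) (g : ℕ → M) :
    𝔼 x ∈ range (b ^ m), g (x / b ^ k % b) = 𝔼 y ∈ range b, g y := by
  obtain ⟨l, rfl⟩ := Nat.exists_eq_add_of_lt hk
  rw [show b ^ (k + l + 1) = b ^ l * b * b ^ k by ring,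
    expect_range_div (pow_pos hb k) _ fun y => g (y % b), expect_range_mod (pow_pos hb l)]

theorem expect_range_pow_prod_digit {A : Type*} [CommSemiring A] [Algebra ℚ≥0 A] {b : ℕ}
    (hb : 0 < b) (m : ℕ) (g : ℕ → A) :
    𝔼 x ∈ range (b ^ m), ∏ k ∈ range m, g (x / b ^ k % b) = (𝔼 y ∈ range b, g y) ^ m := by
  induction m with
  | zero => simp
  | succ m ih =>
    have htop : ∀ i ∈ range b, ∀ j ∈ range (b ^ m), (j + b ^ m * i) / b ^ m % b = i :=
      fun i hi j hj => by
        rw [Nat.add_mul_div_left _ _ (pow_pos hb m), Nat.div_eq_of_lt (mem_range.1 hj), zero_add,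
          Nat.mod_eq_of_lt (mem_range.1 hi)]
    have hlow : ∀ i j, ∀ k ∈ range m, (j + b ^ m * i) / b ^ k % b = j / b ^ k % b :=
      fun i j k hk => by
        obtain ⟨l, rfl⟩ := Nat.exists_eq_add_of_lt (mem_range.1 hk)
        rw [show b ^ (k + l + 1) * i = b ^ k * (b * (b ^ l * i)) by ring,
          Nat.add_mul_div_left _ _ (pow_pos hb k), Nat.add_mul_mod_self_left]
    calc 𝔼 x ∈ range (b ^ (m + 1)), ∏ k ∈ range (m + 1), g (x / b ^ k % b)
        = 𝔼 i ∈ range b, 𝔼 j ∈ range (b ^ m), (∏ k ∈ range m, g (j / b ^ k % b)) * g i := by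
          rw [pow_succ', expect_range_mul]
          refine expect_congr rfl fun i hi => expect_congr rfl fun j hj => ?_
          rw [prod_range_succ, htop i hi j hj, prod_congr rfl fun k hk => by rw [hlow i j k hk]]
      _ = (𝔼 y ∈ range b, g y) ^ (m + 1) := by
          simp only [← expect_mul, ← mul_expect, ih, pow_succ]

end DigitAverages

/-- The walk whose `k`-th step is `1` or `-1` according to the parity of the `k`-th digit of `x` in
base `b`. For `b` even and `x` uniformly distributed on `{0, …, b ^ K - 1}`, its first `K` steps
are those of the simple random walk. -/
def digitWalk (b x j : ℕ) : ℝ :=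
  ∑ k ∈ range j, (-1) ^ (x / b ^ k)

section DigitWalk

variable {b : ℕ}

theorem digitWalk_add (x s p : ℕ) :
    digitWalk b x (s + p) = digitWalk b x s + digitWalk b (x / b ^ s) p := by
  simp only [digitWalk, sum_range_add, pow_add, Nat.div_div_eq_div_mul]

theorem abs_digitWalk_le (x j : ℕ) : |digitWalk b x j| ≤ j := by
  simpa [digitWalk] using abs_sum_le_sum_abs (fun k => (-1 : ℝ) ^ (x / b ^ k)) (range j)

theorem digitWalk_add_mul (hb : Even b) (hb₀ : 0 < b) {j p : ℕ} (hj : j ≤ p) (x y : ℕ) :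
    digitWalk b (x + b ^ p * y) j = digitWalk b x j := by
  refine sum_congr rfl fun k hk => ?_
  obtain ⟨l, rfl⟩ := Nat.exists_eq_add_of_lt ((mem_range.1 hk).trans_le hj)
  rw [show b ^ (k + l + 1) * y = b ^ k * (b * (b ^ l * y)) by ring,
    Nat.add_mul_div_left _ _ (pow_pos hb₀ k), pow_add, (hb.mul_right _).neg_one_pow, mul_one]

theorem digitWalk_mod (hb : Even b) (hb₀ : 0 < b) {j p : ℕ} (hj : j ≤ p) (x : ℕ) :
    digitWalk b (x % b ^ p) j = digitWalk b x j := by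
  rw [← digitWalk_add_mul hb hb₀ hj (x % b ^ p) (x / b ^ p), Nat.mod_add_div]

theorem expect_digitWalk_succ (hb : Even b) (hb₀ : 0 < b) (K : ℕ) (φ : ℝ → ℝ) :
    𝔼 x ∈ range (b ^ (K + 1)), φ (digitWalk b x (K + 1)) =
      𝔼 x ∈ range (b ^ K), (φ (digitWalk b x K + 1) + φ (digitWalk b x K - 1)) / 2 := by
  have hstep : ∀ i, ∀ j ∈ range (b ^ K),
      digitWalk b (j + b ^ K * i) (K + 1) = digitWalk b j K + (-1) ^ i := fun i j hj => by
    rw [digitWalk_add, digitWalk_add_mul hb hb₀ le_rfl, Nat.add_mul_div_left _ _ (pow_pos hb₀ K),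
      Nat.div_eq_of_lt (mem_range.1 hj)]
    simp [digitWalk]
  have hparity : ∀ s : ℝ, 𝔼 i ∈ range b, φ (s + (-1) ^ i) = (φ (s + 1) + φ (s - 1)) / 2 := by
    intro s
    obtain ⟨c, rfl⟩ := hb.exists_two_nsmul
    have hc : (range c).Nonempty := nonempty_range_iff.2 (by simpa using hb₀.ne')
    rw [smul_eq_mul, mul_comm, expect_range_mul]
    simp [pow_add, expect_const hc, expect_eq_sum_div_card, sum_range_succ, sub_eq_add_neg]
  rw [pow_succ', expect_range_mul, expect_comm]
  refine expect_congr rfl fun j hj => ?_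
  rw [← hparity]
  exact expect_congr rfl fun i _ => by rw [hstep i j hj]

theorem expect_neg_digitWalk (hb : Even b) (hb₀ : 0 < b) (K : ℕ) (φ : ℝ → ℝ) :
    𝔼 x ∈ range (b ^ K), φ (-digitWalk b x K) = 𝔼 x ∈ range (b ^ K), φ (digitWalk b x K) := by
  induction K generalizing φ with
  | zero => simp [digitWalk]
  | succ K ih =>
    rw [expect_digitWalk_succ hb hb₀ K φ, expect_digitWalk_succ hb hb₀ K fun s => φ (-s),
      ← ih fun s => (φ (s + 1) + φ (s - 1)) / 2]
    refine expect_congr rfl fun x _ => ?_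
    ring_nf

theorem expect_digitWalk_sq (hb : Even b) (hb₀ : 0 < b) (K : ℕ) :
    𝔼 x ∈ range (b ^ K), digitWalk b x K ^ 2 = K := by
  induction K with
  | zero => simp [digitWalk]
  | succ K ih =>
    have hne : (range (b ^ K)).Nonempty := nonempty_range_iff.2 (pow_pos hb₀ K).ne'
    calc 𝔼 x ∈ range (b ^ (K + 1)), digitWalk b x (K + 1) ^ 2
        = 𝔼 x ∈ range (b ^ K), (digitWalk b x K ^ 2 + 1) := by
          rw [expect_digitWalk_succ hb hb₀ K (· ^ 2)]
          exact expect_congr rfl fun x _ => by ring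
      _ = (K + 1 : ℕ) := by rw [expect_add_distrib, ih, expect_const hne, Nat.cast_succ]

theorem expect_digitWalk_pow_four (hb : Even b) (hb₀ : 0 < b) (K : ℕ) :
    𝔼 x ∈ range (b ^ K), digitWalk b x K ^ 4 = 3 * K ^ 2 - 2 * K := by
  induction K with
  | zero => simp [digitWalk]
  | succ K ih =>
    have hne : (range (b ^ K)).Nonempty := nonempty_range_iff.2 (pow_pos hb₀ K).ne'
    calc 𝔼 x ∈ range (b ^ (K + 1)), digitWalk b x (K + 1) ^ 4
        = 𝔼 x ∈ range (b ^ K), (digitWalk b x K ^ 4 + 6 * digitWalk b x K ^ 2 + 1) := by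
          rw [expect_digitWalk_succ hb hb₀ K (· ^ 4)]
          exact expect_congr rfl fun x _ => by ring
      _ = 3 * (K + 1 : ℕ) ^ 2 - 2 * (K + 1 : ℕ) := by
          rw [expect_add_distrib, expect_add_distrib, ← mul_expect, ih,
            expect_digitWalk_sq hb hb₀, expect_const hne]
          push_cast
          ring

theorem one_div_twenty_le_expect_digitWalk_ge (hb : Even b) (hb₀ : 0 < b) {K : ℕ} (hK : 0 < K) :
    1 / 20 ≤ 𝔼 x ∈ range (b ^ K), if √(K / 2) ≤ digitWalk b x K then (1 : ℝ) else 0 := by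
  have hK' : (0 : ℝ) < K := Nat.cast_pos.2 hK
  have hne : (range (b ^ K)).Nonempty := nonempty_range_iff.2 (pow_pos hb₀ K).ne'
  -- With `t = s² / K`, the left-hand side is `1 - (t - 5)² / 20`, a quadratic in `t` which is at
  -- most `1`, and is negative for `t < 1 / 2`.
  have hquad : ∀ s : ℝ, s ^ 2 / K / 2 - s ^ 4 / K ^ 2 / 20 - 1 / 4 ≤
      (if √(K / 2) ≤ s then (1 : ℝ) else 0) + if √(K / 2) ≤ -s then (1 : ℝ) else 0 := by
    intro s
    have ht : s ^ 4 / K ^ 2 = (s ^ 2 / K) ^ 2 := by ring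
    rw [ht]
    by_cases hs : √(K / 2) ≤ |s|
    · have h1 : (1 : ℝ) ≤ (if √(K / 2) ≤ s then (1 : ℝ) else 0) +
          if √(K / 2) ≤ -s then (1 : ℝ) else 0 := by
        rcases le_abs.1 hs with h | h <;> simp only [h, if_true] <;> split_ifs <;> norm_num
      nlinarith [sq_nonneg (s ^ 2 / K - 5)]
    · have hlt : s ^ 2 / K < 1 / 2 := by
        rw [not_le, Real.lt_sqrt (abs_nonneg s), sq_abs] at hs
        rw [div_lt_iff₀ hK']
        linarith
      have h0 : (0 : ℝ) ≤ (if √(K / 2) ≤ s then (1 : ℝ) else 0) +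
          if √(K / 2) ≤ -s then (1 : ℝ) else 0 := by positivity
      nlinarith [sq_nonneg (s ^ 2 / K)]
  have hmean := expect_le_expect fun x (_ : x ∈ range (b ^ K)) => hquad (digitWalk b x K)
  rw [expect_add_distrib,
    expect_neg_digitWalk hb hb₀ K fun s => if √(K / 2) ≤ s then (1 : ℝ) else 0,
    expect_sub_distrib, expect_sub_distrib, expect_const hne] at hmean
  simp only [← expect_div, expect_digitWalk_sq hb hb₀, expect_digitWalk_pow_four hb hb₀] at hmean
  have hfour : (3 * (K : ℝ) ^ 2 - 2 * K) / K ^ 2 ≤ 3 := by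
    rw [div_le_iff₀ (by positivity)]
    linarith
  rw [div_self hK'.ne'] at hmean
  linarith

end DigitWalk

section Growth

theorem expect_add_mul_pow_le_expect_max {B : ℕ} (hB : 0 < B) (m : ℕ) {w s : ℕ → ℝ} {c g u : ℝ}
    (hc : 0 ≤ c) (hg : m * u + g ≤ (m * c) ^ 2) :
    m * (𝔼 y ∈ range B, w y) +
        g * (𝔼 y ∈ range B, if c ≤ s y ∧ w y ≤ u then 1 else 0) ^ m ≤
      𝔼 x ∈ range (B ^ m), max (∑ i ∈ range m, w (x / B ^ i % B))
        ((∑ i ∈ range m, s (x / B ^ i % B)) ^ 2) := by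
  have hpoint : ∀ y : ℕ → ℕ, ∑ i ∈ range m, w (y i) +
      g * ∏ i ∈ range m, (if c ≤ s (y i) ∧ w (y i) ≤ u then (1 : ℝ) else 0) ≤
        max (∑ i ∈ range m, w (y i)) ((∑ i ∈ range m, s (y i)) ^ 2) := by
    intro y
    by_cases hA : ∀ i ∈ range m, c ≤ s (y i) ∧ w (y i) ≤ u
    · have hs : m * c ≤ ∑ i ∈ range m, s (y i) := by
        simpa using card_nsmul_le_sum _ _ _ fun i hi => (hA i hi).1
      have hw : ∑ i ∈ range m, w (y i) ≤ m * u := by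
        simpa using sum_le_card_nsmul _ _ _ fun i hi => (hA i hi).2
      rw [prod_congr rfl fun i hi => if_pos (hA i hi), prod_const_one, mul_one]
      refine le_max_of_le_right ?_
      have : (m * c) ^ 2 ≤ (∑ i ∈ range m, s (y i)) ^ 2 := by gcongr
      linarith
    · push Not at hA
      obtain ⟨i, hi, hAi⟩ := hA
      rw [prod_eq_zero hi (if_neg fun h => (hAi h.1).not_ge h.2), mul_zero, add_zero]
      exact le_max_left _ _
  calc m * (𝔼 y ∈ range B, w y) +
        g * (𝔼 y ∈ range B, if c ≤ s y ∧ w y ≤ u then (1 : ℝ) else 0) ^ m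
      = 𝔼 x ∈ range (B ^ m), (∑ i ∈ range m, w (x / B ^ i % B) + g * ∏ i ∈ range m,
          if c ≤ s (x / B ^ i % B) ∧ w (x / B ^ i % B) ≤ u then (1 : ℝ) else 0) := by
        rw [expect_add_distrib, expect_sum_comm, ← mul_expect, expect_range_pow_prod_digit hB m
          fun y => if c ≤ s y ∧ w y ≤ u then (1 : ℝ) else 0,
          sum_congr rfl fun i hi => expect_range_pow_digit hB (mem_range.1 hi) w]
        simp
    _ ≤ _ := expect_le_expect fun x _ => hpoint _

/-- The average of `blockVar m n` along a random `digitWalk`, relative to the variance `m ^ n` of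
that walk. -/
noncomputable def meanBlockVar (b m n : ℕ) : ℝ :=
  (𝔼 x ∈ range (b ^ m ^ n), blockVar m n (digitWalk b x) 0) / m ^ n

variable {b m : ℕ}

theorem meanBlockVar_nonneg (n : ℕ) : 0 ≤ meanBlockVar b m n :=
  div_nonneg (expect_nonneg fun _ _ => blockVar_nonneg _ _ _ _) (by positivity)

theorem blockVar_succ_digitWalk (hb : Even b) (hb₀ : 0 < b) (hm : 0 < m) (n x : ℕ) :
    blockVar m (n + 1) (digitWalk b x) 0 =
      max (∑ i ∈ range m,
          blockVar m n (digitWalk b (x / (b ^ m ^ n) ^ i % b ^ m ^ n)) 0)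
        ((∑ i ∈ range m, digitWalk b (x / (b ^ m ^ n) ^ i % b ^ m ^ n) (m ^ n)) ^ 2) := by
  have hblock : ∀ i, ∀ j ≤ m ^ n, digitWalk b x (m ^ n * i + j) =
      digitWalk b x (m ^ n * i) + digitWalk b (x / (b ^ m ^ n) ^ i % b ^ m ^ n) j := by
    intro i j hj
    rw [digitWalk_add, digitWalk_mod hb hb₀ hj, pow_mul]
  have hwalk : ∀ k, digitWalk b x (m ^ n * k) =
      ∑ i ∈ range k, digitWalk b (x / (b ^ m ^ n) ^ i % b ^ m ^ n) (m ^ n) := by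
    intro k
    induction k with
    | zero => simp [digitWalk]
    | succ k ih => rw [Nat.mul_succ, hblock k _ le_rfl, ih, sum_range_succ]
  rw [blockVar]
  congr 1
  · refine sum_congr rfl fun i _ => blockVar_congr hm n fun j hj l hl => ?_
    simp only [zero_add, hblock i j hj, hblock i l hl, add_sub_add_left_eq_sub]
  · rw [zero_add, pow_succ m, hwalk, Real.norm_eq_abs, sq_abs]
    simp [digitWalk]

theorem one_div_forty_le_expect_digitWalk_ge_and_blockVar_le (hb : Even b) (hb₀ : 0 < b)
    (hm : 0 < m) {n : ℕ} {C : ℝ} (hC : 0 < C) (h : meanBlockVar b m n ≤ C) :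
    1 / 40 ≤ 𝔼 y ∈ range (b ^ m ^ n), if √((m ^ n : ℕ) / 2) ≤ digitWalk b y (m ^ n) ∧
      blockVar m n (digitWalk b y) 0 ≤ 40 * C * m ^ n then (1 : ℝ) else 0 := by
  have hm' : (0 : ℝ) < m ^ n := by positivity
  -- Markov's inequality
  have hmarkov : ∀ y, (if √((m ^ n : ℕ) / 2) ≤ digitWalk b y (m ^ n) then (1 : ℝ) else 0) -
      blockVar m n (digitWalk b y) 0 / (40 * C * m ^ n) ≤
        if √((m ^ n : ℕ) / 2) ≤ digitWalk b y (m ^ n) ∧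
          blockVar m n (digitWalk b y) 0 ≤ 40 * C * m ^ n then (1 : ℝ) else 0 := by
    intro y
    have hpos : 0 ≤ blockVar m n (digitWalk b y) 0 / (40 * C * m ^ n) :=
      div_nonneg (blockVar_nonneg _ _ _ _) (by positivity)
    by_cases hw : blockVar m n (digitWalk b y) 0 ≤ 40 * C * m ^ n
    · simpa only [hw, and_true] using sub_le_self _ hpos
    · have := (one_lt_div (by positivity)).2 (not_le.1 hw)
      simp only [hw, and_false, if_false]
      split_ifs <;> linarith
  have hmean := expect_le_expect fun y (_ : y ∈ range (b ^ m ^ n)) => hmarkov y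
  have hwalk := one_div_twenty_le_expect_digitWalk_ge hb hb₀ (pow_pos hm n)
  have hblock : (𝔼 y ∈ range (b ^ m ^ n), blockVar m n (digitWalk b y) 0) / (40 * C * m ^ n) ≤
      1 / 40 := by
    rw [meanBlockVar, div_le_iff₀ hm'] at h
    rw [div_le_div_iff₀ (by positivity) (by norm_num)]
    linarith
  rw [expect_sub_distrib, ← expect_div] at hmean
  linarith

theorem meanBlockVar_le_succ (hb : Even b) (hb₀ : 0 < b) (hm : 0 < m) (n : ℕ) :
    meanBlockVar b m n ≤ meanBlockVar b m (n + 1) := by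
  have hgain := expect_add_mul_pow_le_expect_max (B := b ^ m ^ n) (pow_pos hb₀ _) m
    (w := fun y => blockVar m n (digitWalk b y) 0) (s := fun y => digitWalk b y (m ^ n))
    (c := 0) (g := 0) (u := 0) le_rfl (by simp)
  rw [meanBlockVar, meanBlockVar, div_le_div_iff₀ (by positivity) (by positivity), pow_succ m,
    pow_mul b, pow_succ (m : ℝ)]
  simp only [blockVar_succ_digitWalk hb hb₀ hm]
  have hm' : (0 : ℝ) < m ^ n := by positivity
  nlinarith

theorem meanBlockVar_add_le_succ (hb : Even b) (hb₀ : 0 < b) (hm : 0 < m) {n : ℕ} {C : ℝ}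
    (hC : 0 < C) (hmC : 160 * C ≤ m) (h : meanBlockVar b m n ≤ C) :
    meanBlockVar b m n + 40 * C / 40 ^ m ≤ meanBlockVar b m (n + 1) := by
  have hK : (0 : ℝ) < m ^ n := by positivity
  have hm' : (0 : ℝ) < m := Nat.cast_pos.2 hm
  have hprob := one_div_forty_le_expect_digitWalk_ge_and_blockVar_le hb hb₀ hm hC h
  have hgain := expect_add_mul_pow_le_expect_max (B := b ^ m ^ n) (pow_pos hb₀ _) m
    (w := fun y => blockVar m n (digitWalk b y) 0) (s := fun y => digitWalk b y (m ^ n))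
    (c := √((m ^ n : ℕ) / 2)) (g := 40 * C * m * m ^ n) (u := 40 * C * m ^ n) (Real.sqrt_nonneg _)
    (by
      rw [mul_pow, Real.sq_sqrt (by positivity), Nat.cast_pow]
      nlinarith [mul_pos hm' hK])
  calc meanBlockVar b m n + 40 * C / 40 ^ m
      = (m * (𝔼 y ∈ range (b ^ m ^ n), blockVar m n (digitWalk b y) 0) +
          40 * C * m * m ^ n * (1 / 40) ^ m) / m ^ (n + 1) := by
        rw [meanBlockVar, one_div_pow]
        field_simp
        ring
    _ ≤ meanBlockVar b m (n + 1) := by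
        rw [meanBlockVar]
        simp only [blockVar_succ_digitWalk hb hb₀ hm]
        rw [pow_succ m, pow_mul b]
        gcongr
        refine le_trans ?_ hgain
        gcongr

theorem min_le_meanBlockVar (hb : Even b) (hb₀ : 0 < b) (hm : 0 < m) {C : ℝ} (hC : 0 < C)
    (hmC : 160 * C ≤ m) (n : ℕ) : min C (n * (40 * C / 40 ^ m)) ≤ meanBlockVar b m n := by
  have hgain : 0 < 40 * C / 40 ^ m := by positivity
  induction n with
  | zero => exact (min_le_right _ _).trans (by simpa using meanBlockVar_nonneg 0)
  | succ n ih =>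
    rcases le_total C (meanBlockVar b m n) with h | h
    · exact (min_le_left _ _).trans (h.trans (meanBlockVar_le_succ hb hb₀ hm n))
    · have hsucc := meanBlockVar_add_le_succ hb hb₀ hm hC hmC h
      push_cast
      rcases min_le_iff.1 ih with h' | h'
      · exact (min_le_left _ _).trans (by linarith)
      · exact (min_le_right _ _).trans (by linarith)

theorem exists_forall_even_le_meanBlockVar (C : ℝ) :
    ∃ m n : ℕ, 0 < m ∧ ∀ b, Even b → 0 < b → C ≤ meanBlockVar b m n := by
  obtain ⟨m, hm⟩ := exists_nat_ge (max (160 * max C 1) 1)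
  have hC : 0 < max C 1 := lt_max_of_lt_right one_pos
  have hgain : 0 < 40 * max C 1 / 40 ^ m := by positivity
  have hm₀ : 0 < m := by exact_mod_cast one_pos.trans_le ((le_max_right _ _).trans hm)
  obtain ⟨n, hn⟩ := exists_nat_ge (max C 1 / (40 * max C 1 / 40 ^ m))
  refine ⟨m, n, hm₀, fun b hb hb₀ => ?_⟩
  have hmin := min_le_meanBlockVar hb hb₀ hm₀ hC ((le_max_left _ _).trans hm) n
  rw [min_eq_left ((div_le_iff₀ hgain).1 hn)] at hmin
  exact (le_max_left _ _).trans hmin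

end Growth

section SquareWave

theorem alternating_sum_bounds {R : Type*} [CommRing R] [LinearOrder R] [IsStrictOrderedRing R]
    {c : ℕ → R} (hc : ∀ i, 0 ≤ c i) (hstep : ∀ i, c (i + 1) ≤ c i + 1) (I : ℕ) :
    -(I : R) ≤ ∑ i ∈ range I, (-1) ^ i * c i ∧ ∑ i ∈ range I, (-1) ^ i * c i ≤ c 0 + I := by
  induction I generalizing c with
  | zero => simpa using hc 0
  | succ I ih =>
    obtain ⟨hlow, hup⟩ := ih (fun i => hc (i + 1)) fun i => hstep (i + 1)
    have hsum : ∑ i ∈ range (I + 1), (-1) ^ i * c i =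
        c 0 - ∑ i ∈ range I, (-1) ^ i * c (i + 1) := by
      simp [sum_range_succ', pow_succ, neg_add_eq_sub]
    rw [hsum, Nat.cast_succ]
    constructor <;> linarith [hstep 0, hc 0]

theorem sqrt_add_two_mul_add_sqrt_le (u M : ℕ) :
    Nat.sqrt (u + 2 * M) + Nat.sqrt u ≤ 2 * Nat.sqrt (u + M) + 1 := by
  have hupper := Nat.sqrt_le' (u + 2 * M)
  have hlower := Nat.sqrt_le' u
  have hmiddle := Nat.lt_succ_sqrt' (u + M)
  by_contra! h
  have hsq := Nat.pow_le_pow_left h 2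
  zify at *
  nlinarith [sq_nonneg ((Nat.sqrt (u + 2 * M) : ℤ) - Nat.sqrt u)]

variable {M x : ℕ}

theorem card_sq_div_lt (hM : 0 < M) (x N i : ℕ) :
    #{n ∈ Icc 1 N | (x + n ^ 2) / M < i} = min N (Nat.sqrt (i * M - 1 - x)) := by
  have hIcc : {n ∈ Icc 1 N | (x + n ^ 2) / M < i} =
      Icc 1 (min N (Nat.sqrt (i * M - 1 - x))) := by
    ext n
    rw [mem_filter, mem_Icc, mem_Icc, Nat.div_lt_iff_lt_mul hM, le_min_iff, Nat.le_sqrt', and_assoc]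
    refine and_congr_right fun hn => and_congr_right fun _ => ?_
    have : 0 < n ^ 2 := pow_pos hn 2
    lia
  rw [hIcc, Nat.card_Icc, Nat.add_sub_cancel]

theorem card_sq_div_lt_add_card_sq_div_eq (M x N i : ℕ) :
    #{n ∈ Icc 1 N | (x + n ^ 2) / M < i} + #{n ∈ Icc 1 N | (x + n ^ 2) / M = i} =
      #{n ∈ Icc 1 N | (x + n ^ 2) / M < i + 1} := by
  rw [← card_union_of_disjoint (disjoint_filter.2 fun _ _ h => h.ne), ← filter_or]
  simp only [Nat.lt_succ_iff_lt_or_eq]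

theorem card_sq_div_eq_succ_le (hM : 0 < M) (hx : x < M) (N i : ℕ) :
    #{n ∈ Icc 1 N | (x + n ^ 2) / M = i + 2} ≤ #{n ∈ Icc 1 N | (x + n ^ 2) / M = i + 1} + 1 := by
  have h₁ := card_sq_div_lt_add_card_sq_div_eq M x N (i + 1)
  have h₂ := card_sq_div_lt_add_card_sq_div_eq M x N (i + 2)
  have hconc := sqrt_add_two_mul_add_sqrt_le ((i + 1) * M - 1 - x) M
  rw [show (i + 1) * M - 1 - x + M = (i + 2) * M - 1 - x by lia,
    show (i + 1) * M - 1 - x + 2 * M = (i + 3) * M - 1 - x by lia] at hconc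
  simp only [card_sq_div_lt hM, add_assoc, Nat.reduceAdd] at h₁ h₂
  lia

theorem card_sq_div_eq_zero_add_card_sq_div_eq_one_le (hM : 0 < M) (x N : ℕ) :
    #{n ∈ Icc 1 N | (x + n ^ 2) / M = 0} + #{n ∈ Icc 1 N | (x + n ^ 2) / M = 1} ≤
      Nat.sqrt (2 * M) := by
  have h₁ := card_sq_div_lt_add_card_sq_div_eq M x N 1
  have h₂ : #{n ∈ Icc 1 N | (x + n ^ 2) / M < 2} ≤ Nat.sqrt (2 * M) := by
    rw [card_sq_div_lt hM]
    exact (min_le_right _ _).trans (Nat.sqrt_le_sqrt (by lia))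
  lia

theorem abs_sum_neg_one_pow_sq_div_le_of_lt (hM : 0 < M) (hx : x < M) (N : ℕ) :
    |∑ n ∈ Icc 1 N, (-1 : ℝ) ^ ((x + n ^ 2) / M)| ≤
      Nat.sqrt (2 * M) + (N ^ 2 / M : ℕ) + 1 := by
  set c : ℕ → ℝ := fun i => (#{n ∈ Icc 1 N | (x + n ^ 2) / M = i} : ℝ) with hc
  have hmaps : ∀ n ∈ Icc 1 N, (x + n ^ 2) / M ∈ range (N ^ 2 / M + 1 + 1) := fun n hn => by
    rw [mem_range, Nat.lt_succ_iff, ← Nat.add_div_right _ hM]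
    have := Nat.pow_le_pow_left (mem_Icc.1 hn).2 2
    exact Nat.div_le_div_right (by lia)
  have hfiber : ∑ n ∈ Icc 1 N, (-1 : ℝ) ^ ((x + n ^ 2) / M) =
      c 0 - ∑ i ∈ range (N ^ 2 / M + 1), (-1) ^ i * c (i + 1) := by
    rw [← sum_fiberwise_of_maps_to' hmaps fun i => (-1 : ℝ) ^ i, sum_range_succ']
    simp [hc, pow_succ, neg_add_eq_sub, mul_comm]
  have hstep : ∀ i, c (i + 1 + 1) ≤ c (i + 1) + 1 := fun i => by
    simp only [hc]
    exact_mod_cast card_sq_div_eq_succ_le hM hx N i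
  have hfirst : c 0 + c 1 ≤ Nat.sqrt (2 * M) := by
    simp only [hc]
    exact_mod_cast card_sq_div_eq_zero_add_card_sq_div_eq_one_le hM x N
  have hc₀ : ∀ i, 0 ≤ c i := fun i => Nat.cast_nonneg _
  obtain ⟨hlow, hup⟩ := alternating_sum_bounds (fun i => hc₀ (i + 1)) hstep (N ^ 2 / M + 1)
  rw [zero_add, Nat.cast_succ] at *
  rw [hfiber, abs_le]
  constructor <;> linarith [hc₀ 0, hc₀ 1]

theorem abs_sum_neg_one_pow_sq_div_le (hM : 0 < M) (x N : ℕ) :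
    |∑ n ∈ Icc 1 N, (-1 : ℝ) ^ ((x + n ^ 2) / M)| ≤
      Nat.sqrt (2 * M) + (N ^ 2 / M : ℕ) + 1 := by
  have hmod : ∀ n, (-1 : ℝ) ^ ((x + n ^ 2) / M) =
      (-1) ^ (x / M) * (-1) ^ ((x % M + n ^ 2) / M) := fun n => by
    rw [← pow_add, ← Nat.mul_add_div hM, ← add_assoc, Nat.div_add_mod]
  simp only [hmod, ← mul_sum, abs_mul, abs_neg_one_pow, one_mul]
  exact abs_sum_neg_one_pow_sq_div_le_of_lt hM (Nat.mod_lt x hM) N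

theorem norm_mean_neg_one_pow_sq_div_le {q L N : ℕ} (hq : 0 < q) (hL : 0 < L) (hLN : q * L ≤ N)
    (hNL : q * N ≤ L ^ 2) (x : ℕ) :
    ‖1 / (N : ℂ) * ∑ n ∈ Icc 1 N, (-1) ^ ((x + n ^ 2) / L ^ 2)‖ ≤ 4 / q := by
  have hN : 0 < N := (Nat.mul_pos hq hL).trans_le hLN
  have hcast : ‖∑ n ∈ Icc 1 N, (-1 : ℂ) ^ ((x + n ^ 2) / L ^ 2)‖ =
      |∑ n ∈ Icc 1 N, (-1 : ℝ) ^ ((x + n ^ 2) / L ^ 2)| := by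
    rw [← Real.norm_eq_abs, ← Complex.norm_real]
    push_cast
    rfl
  have hsqrt : Nat.sqrt (2 * L ^ 2) ≤ 2 * L :=
    (Nat.sqrt_lt'.2 (by nlinarith [Nat.pow_pos (n := 2) hL])).le
  have hdiv : q * (N ^ 2 / L ^ 2) ≤ N :=
    (Nat.mul_div_le_mul_div_assoc _ _ _).trans (Nat.div_le_of_le_mul (by nlinarith))
  have hmain : (Nat.sqrt (2 * L ^ 2) + N ^ 2 / L ^ 2 + 1) * q ≤ 4 * N := by nlinarith
  rw [norm_mul, hcast, norm_div, norm_one, Complex.norm_natCast, one_div, inv_mul_eq_div,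
    div_le_div_iff₀ (Nat.cast_pos.2 hN) (Nat.cast_pos.2 hq)]
  calc |∑ n ∈ Icc 1 N, (-1 : ℝ) ^ ((x + n ^ 2) / L ^ 2)| * q
      ≤ (Nat.sqrt (2 * L ^ 2) + (N ^ 2 / L ^ 2 : ℕ) + 1) * q := by
        gcongr
        exact abs_sum_neg_one_pow_sq_div_le (by positivity) x N
    _ ≤ 4 * N := by exact_mod_cast hmain

end SquareWave

section SquareMean

variable {X : Type*} {S : X → X} {f : X → ℂ} {N : ℕ+} {x : X}

theorem squareMean_sum {ι : Type*} (s : Finset ι) (S : X → X) (f : ι → X → ℂ) (N : ℕ+) (x : X) :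
    squareMean S (fun y => ∑ k ∈ s, f k y) N x = ∑ k ∈ s, squareMean S (f k) N x := by
  simp only [squareMean]
  rw [sum_comm, mul_sum]

theorem squareMean_const_mul (T : X → X) (c : ℂ) (f : X → ℂ) (N : ℕ+) (x : X) :
    squareMean T (fun y => c * f y) N x = c * squareMean T f N x := by
  rw [squareMean, squareMean, ← mul_sum, mul_left_comm]

theorem squareMean_eq_self (h : ∀ n ∈ Icc 1 (N : ℕ), f (S^[n ^ 2] x) = f x) :
    squareMean S f N x = f x := by
  rw [squareMean, sum_congr rfl h, sum_const, Nat.card_Icc, Nat.add_sub_cancel, nsmul_eq_mul,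
    ← mul_assoc, one_div_mul_cancel (by exact_mod_cast N.ne_zero), one_mul]

theorem norm_squareMean_le {A : ℝ} (h : ∀ y, ‖f y‖ ≤ A) : ‖squareMean S f N x‖ ≤ A := by
  have hN : (0 : ℝ) < (N : ℕ) := Nat.cast_pos.2 N.pos
  have hsum : ‖∑ n ∈ Icc 1 (N : ℕ), f (S^[n ^ 2] x)‖ ≤ (N : ℕ) * A := by
    simpa using norm_sum_le_of_le (Icc 1 (N : ℕ)) fun n _ => h (S^[n ^ 2] x)
  rw [squareMean, norm_mul, norm_div, norm_one, Complex.norm_natCast, one_div, inv_mul_le_iff₀ hN]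
  exact hsum

end SquareMean

section Model

/-- A function on `ℕ` whose averages along squares follow a random walk: the superposition of `K`
square waves whose half-periods `q ^ (4 * (K + k) + 4)`, `k < K`, are widely separated. -/
noncomputable def waveModel (q K x : ℕ) : ℝ :=
  digitWalk (q ^ 4) (x / q ^ (4 * K + 4)) K

variable {q K j : ℕ}

theorem digitWalk_div_eq_sum (q K j x : ℕ) :
    digitWalk (q ^ 4) (x / q ^ (4 * K + 4)) j =
      ∑ k ∈ range j, (-1) ^ (x / q ^ (4 * (K + k) + 4)) := by
  refine sum_congr rfl fun k _ => ?_
  rw [Nat.div_div_eq_div_mul, ← pow_mul, ← pow_add]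
  ring_nf

theorem abs_waveModel_le (q K x : ℕ) : |waveModel q K x| ≤ K :=
  abs_digitWalk_le _ _

theorem periodic_waveModel (hq : Even q) (hq₀ : 0 < q) (K : ℕ) :
    Function.Periodic (waveModel q K) (q ^ (4 * (K + K) + 4)) := by
  intro x
  have hpow : q ^ (4 * (K + K) + 4) = q ^ (4 * K + 4) * ((q ^ 4) ^ K * 1) := by ring
  rw [waveModel, hpow, Nat.add_mul_div_left _ _ (by positivity),
    digitWalk_add_mul (hq.pow_of_ne_zero four_ne_zero) (by positivity) le_rfl, waveModel]

/-- The number of squares after which the averages of `waveModel q K` have lost exactly their first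
`j` waves. It lies halfway, on a logarithmic scale, between what makes wave `j - 1` average out and
what wave `j` cannot resolve. -/
def waveTime (q K j : ℕ) : ℕ :=
  q ^ (2 * (K + j) + 1)

theorem add_div_eq_of_mod_add_lt {M m n x : ℕ} (hdvd : M ∣ m) (hx : x % M + n < M) :
    (x + n) / m = x / m := by
  obtain ⟨c, rfl⟩ := hdvd
  have hM : (x + n) / M = x / M := by
    rw [← Nat.div_add_mod x M, add_assoc, Nat.mul_add_div (by lia), Nat.mul_add_div (by lia),
      Nat.div_eq_of_lt hx, Nat.div_eq_of_lt (Nat.mod_lt _ (by lia))]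
  rw [← Nat.div_div_eq_div_mul, hM, Nat.div_div_eq_div_mul]

theorem squareMean_wave_eq {k : ℕ} (hjk : j ≤ k) {N : ℕ+} {x : ℕ}
    (hx : x % q ^ (4 * (K + j) + 4) + N ^ 2 < q ^ (4 * (K + j) + 4)) :
    squareMean Nat.succ (fun y => (-1) ^ (y / q ^ (4 * (K + k) + 4))) N x =
      (-1) ^ (x / q ^ (4 * (K + k) + 4)) := by
  refine squareMean_eq_self fun n hn => ?_
  have hn : n ^ 2 ≤ N ^ 2 := Nat.pow_le_pow_left (mem_Icc.1 hn).2 2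
  have hdvd : q ^ (4 * (K + j) + 4) ∣ q ^ (4 * (K + k) + 4) := pow_dvd_pow q (by lia)
  rw [Nat.succ_iterate, add_div_eq_of_mod_add_lt hdvd (by lia)]

theorem norm_squareMean_wave_le (hq : 0 < q) {k : ℕ} (hkj : k < j) (hjK : j ≤ K) {N : ℕ+}
    (hN : (N : ℕ) = waveTime q K j) (x : ℕ) :
    ‖squareMean Nat.succ (fun y => (-1) ^ (y / q ^ (4 * (K + k) + 4))) N x‖ ≤ 4 / q := by
  have hpow : q ^ (4 * (K + k) + 4) = (q ^ (2 * (K + k) + 2)) ^ 2 := by ring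
  simp only [squareMean, Nat.succ_iterate, hpow, hN, waveTime]
  refine norm_mean_neg_one_pow_sq_div_le hq (by positivity) ?_ ?_ x
  · rw [← pow_succ']
    exact Nat.pow_le_pow_right hq (by lia)
  · rw [← pow_succ', ← pow_mul]
    exact Nat.pow_le_pow_right hq (by lia)

theorem norm_squareMean_waveModel_sub_le (hq : 0 < q) (hjK : j ≤ K) {N : ℕ+}
    (hN : (N : ℕ) = waveTime q K j) {x : ℕ}
    (hx : x % q ^ (4 * (K + j) + 4) + waveTime q K j ^ 2 < q ^ (4 * (K + j) + 4)) :
    ‖squareMean Nat.succ (fun y => (waveModel q K y : ℂ)) N x -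
      (waveModel q K x - digitWalk (q ^ 4) (x / q ^ (4 * K + 4)) j : ℝ)‖ ≤ 4 * K / q := by
  have hlow : ∀ k ∈ range j, ‖squareMean Nat.succ
      (fun y => (-1) ^ (y / q ^ (4 * (K + k) + 4))) N x‖ ≤ 4 / q :=
    fun k hk => norm_squareMean_wave_le hq (mem_range.1 hk) hjK hN x
  have hhigh : ∀ k ∈ Ico j K, squareMean Nat.succ
      (fun y => (-1) ^ (y / q ^ (4 * (K + k) + 4))) N x = (-1) ^ (x / q ^ (4 * (K + k) + 4)) :=
    fun k hk => squareMean_wave_eq (mem_Ico.1 hk).1 (by rwa [hN])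
  simp only [waveModel, digitWalk_div_eq_sum, ← sum_range_add_sum_Ico _ hjK, add_sub_cancel_left]
  push_cast
  rw [funext fun y => (sum_range_add_sum_Ico (fun k => (-1 : ℂ) ^ (y / q ^ (4 * (K + k) + 4))) hjK),
    squareMean_sum, ← sum_range_add_sum_Ico _ hjK, sum_congr rfl hhigh, add_sub_cancel_right]
  calc ‖∑ k ∈ range j, squareMean Nat.succ (fun y => (-1) ^ (y / q ^ (4 * (K + k) + 4))) N x‖
      ≤ j * (4 / q) := by simpa using norm_sum_le_of_le _ hlow
    _ ≤ 4 * K / q := by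
        rw [mul_comm, div_mul_eq_mul_div]
        gcongr

/-- The points where, for some `j ≤ K`, the averages of `waveModel q K` at time `waveTime q K j`
see a jump of a wave that they ought not to resolve. -/
def waveJumps (q K : ℕ) : Set ℕ :=
  {x | ∃ j ≤ K, q ^ (4 * (K + j) + 4) ≤ x % q ^ (4 * (K + j) + 4) + waveTime q K j ^ 2}

theorem digitWalk_sub_sq_le (hq : 0 < q) {N : ℕ → ℕ+} (hN : ∀ j, (N j : ℕ) = waveTime q K j)
    {i j : ℕ} (hi : i ≤ K) (hj : j ≤ K) (x : ℕ) :
    ‖digitWalk (q ^ 4) (x / q ^ (4 * K + 4)) i - digitWalk (q ^ 4) (x / q ^ (4 * K + 4)) j‖ ^ 2 ≤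
      ‖squareMean Nat.succ (fun y => (waveModel q K y : ℂ)) (N i) x -
        squareMean Nat.succ (fun y => (waveModel q K y : ℂ)) (N j) x‖ ^ 2 +
      (32 * K ^ 2 / q + 4 * K ^ 2 * (waveJumps q K).indicator (fun _ => 1) x) := by
  set w : ℕ → ℝ := digitWalk (q ^ 4) (x / q ^ (4 * K + 4))
  set a : ℕ → ℂ := fun j => squareMean Nat.succ (fun y => (waveModel q K y : ℂ)) (N j) x
  have hw : ∀ j ≤ K, ‖w j‖ ≤ K := fun j hj =>
    (abs_digitWalk_le _ _).trans (by exact_mod_cast hj)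
  have ha : ∀ j, ‖a j‖ ≤ K := fun j => norm_squareMean_le fun y => by
    simpa only [Complex.norm_real, Real.norm_eq_abs] using abs_waveModel_le q K y
  have hwij : ‖w i - w j‖ ≤ 2 * K := (norm_sub_le _ _).trans (by linarith [hw i hi, hw j hj])
  have haij : ‖a i - a j‖ ≤ 2 * K := (norm_sub_le _ _).trans (by linarith [ha i, ha j])
  have herr : 0 ≤ 32 * (K : ℝ) ^ 2 / q := by positivity
  by_cases hx : x ∈ waveJumps q K
  · rw [Set.indicator_of_mem hx]
    have := pow_le_pow_left₀ (norm_nonneg _) hwij 2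
    linarith [sq_nonneg ‖a i - a j‖]
  · have happrox : ∀ j ≤ K, ‖a j - (waveModel q K x - w j : ℝ)‖ ≤ 4 * K / q := fun j hj =>
      norm_squareMean_waveModel_sub_le hq hj (hN j) (not_le.1 fun h => hx ⟨j, hj, h⟩)
    have hclose : ‖w i - w j‖ ≤ ‖a i - a j‖ + 8 * K / q := by
      calc ‖w i - w j‖ = ‖((w i - w j : ℝ) : ℂ)‖ := (Complex.norm_real _).symm
        _ = ‖-(a i - a j) + (a i - (waveModel q K x - w i : ℝ)) -
              (a j - (waveModel q K x - w j : ℝ))‖ := by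
            congr 1
            push_cast
            ring
        _ ≤ ‖a i - a j‖ + 4 * K / q + 4 * K / q := by
            refine (norm_sub_le _ _).trans (add_le_add ?_ (happrox j hj))
            exact (norm_add_le _ _).trans (add_le_add (norm_neg _).le (happrox i hi))
        _ = ‖a i - a j‖ + 8 * K / q := by ring
    have hq' : 0 ≤ 8 * (K : ℝ) / q := by positivity
    rw [Set.indicator_of_notMem hx, show 32 * (K : ℝ) ^ 2 / q = 8 * K / q * (4 * K) by ring]
    nlinarith [norm_nonneg (w i - w j), norm_nonneg (a i - a j)]

theorem expect_waveJumps_le (hq : 0 < q) (K : ℕ) :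
    𝔼 x ∈ range (q ^ (4 * (K + K) + 4)), (waveJumps q K).indicator (fun _ => (1 : ℝ)) x ≤
      (K + 1) / q := by
  have hunion : ∀ x, (waveJumps q K).indicator (fun _ => (1 : ℝ)) x ≤ ∑ j ∈ range (K + 1),
      if q ^ (4 * (K + j) + 4) ≤ x % q ^ (4 * (K + j) + 4) + waveTime q K j ^ 2 then 1 else 0 := by
    intro x
    by_cases hx : x ∈ waveJumps q K
    · rw [Set.indicator_of_mem hx]
      obtain ⟨j, hj, hxj⟩ := hx
      exact le_of_eq_of_le (if_pos hxj).symm (single_le_sum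
        (f := fun j => if q ^ (4 * (K + j) + 4) ≤ x % q ^ (4 * (K + j) + 4) + waveTime q K j ^ 2
          then (1 : ℝ) else 0) (fun _ _ => by positivity) (mem_range_succ_iff.2 hj))
    · rw [Set.indicator_of_notMem hx]
      positivity
  have hdensity : ∀ j ∈ range (K + 1), 𝔼 x ∈ range (q ^ (4 * (K + K) + 4)),
      (if q ^ (4 * (K + j) + 4) ≤ x % q ^ (4 * (K + j) + 4) + waveTime q K j ^ 2 then (1 : ℝ)
        else 0) ≤ 1 / q := by
    intro j hj
    obtain ⟨l, rfl⟩ := Nat.exists_eq_add_of_le (mem_range_succ_iff.1 hj)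
    have hq₁ : (1 : ℝ) ≤ q := by exact_mod_cast hq
    rw [show q ^ (4 * (j + l + (j + l)) + 4) = q ^ (4 * l) * q ^ (4 * (j + l + j) + 4) by ring]
    refine (expect_range_mul_le_mod_add_le (by positivity) _ _).trans ?_
    rw [waveTime, div_le_div_iff₀ (by positivity) (by positivity), one_mul]
    push_cast
    rw [← pow_mul, ← pow_succ]
    exact pow_le_pow_right₀ hq₁ (by lia)
  calc _ ≤ ∑ j ∈ range (K + 1), 𝔼 x ∈ range (q ^ (4 * (K + K) + 4)),
        (if q ^ (4 * (K + j) + 4) ≤ x % q ^ (4 * (K + j) + 4) + waveTime q K j ^ 2 then (1 : ℝ)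
          else 0) := by
        rw [← expect_sum_comm]
        exact expect_le_expect fun x _ => hunion x
    _ ≤ (K + 1) / q := by simpa [div_eq_mul_inv] using sum_le_card_nsmul _ _ _ hdensity

theorem sum_norm_waveModel_sq (hq : Even q) (hq₀ : 0 < q) (K : ℕ) :
    ∑ x ∈ range (q ^ (4 * (K + K) + 4)), ‖(waveModel q K x : ℂ)‖ ^ 2 =
      (q ^ (4 * (K + K) + 4) : ℕ) * K := by
  have hmean : 𝔼 x ∈ range (q ^ (4 * (K + K) + 4)), waveModel q K x ^ 2 = K := by
    rw [show q ^ (4 * (K + K) + 4) = (q ^ 4) ^ K * q ^ (4 * K + 4) by ring]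
    simp only [waveModel]
    rw [expect_range_div (by positivity) _ fun y => digitWalk (q ^ 4) y K ^ 2,
      expect_digitWalk_sq (hq.pow_of_ne_zero four_ne_zero) (by positivity)]
  simp only [Complex.norm_real, Real.norm_eq_abs, sq_abs]
  rw [← card_mul_expect, card_range, hmean]

theorem meanBlockVar_sub_mul_le_expect_blockVar_squareMean (hq : 0 < q) {m n : ℕ}
    (hm : 0 < m) (hK : m ^ n = K) {N : ℕ → ℕ+} (hN : ∀ j, (N j : ℕ) = waveTime q K j) :
    (meanBlockVar (q ^ 4) m n - (32 * K ^ 2 + 4 * K ^ 2 * (K + 1)) / q) * K ≤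
      𝔼 x ∈ range (q ^ (4 * (K + K) + 4)), blockVar m n
        (fun j => squareMean Nat.succ (fun y => (waveModel q K y : ℂ)) (N j) x) 0 := by
  have hK' : (m : ℝ) ^ n = K := by exact_mod_cast hK
  have hK₀ : 0 < (K : ℝ) := hK' ▸ by positivity
  have hrange : (range (q ^ (4 * (K + K) + 4))).Nonempty :=
    nonempty_range_iff.2 (pow_pos hq _).ne'
  have hwalk : 𝔼 x ∈ range (q ^ (4 * (K + K) + 4)),
      blockVar m n (digitWalk (q ^ 4) (x / q ^ (4 * K + 4))) 0 = meanBlockVar (q ^ 4) m n * K := by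
    rw [show q ^ (4 * (K + K) + 4) = (q ^ 4) ^ K * q ^ (4 * K + 4) by ring,
      expect_range_div (by positivity) _ fun y => blockVar m n (digitWalk (q ^ 4) y) 0,
      meanBlockVar, hK', hK, div_mul_cancel₀ _ hK₀.ne']
  have hcompare : ∀ x, blockVar m n (digitWalk (q ^ 4) (x / q ^ (4 * K + 4))) 0 ≤ blockVar m n
      (fun j => squareMean Nat.succ (fun y => (waveModel q K y : ℂ)) (N j) x) 0 +
        K * (32 * K ^ 2 / q + 4 * K ^ 2 * (waveJumps q K).indicator (fun _ => 1) x) := by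
    intro x
    have hδ : 0 ≤ (waveJumps q K).indicator (fun _ => (1 : ℝ)) x :=
      Set.indicator_nonneg (fun _ _ => zero_le_one) x
    rw [← hK']
    refine blockVar_le_add hm (by positivity) n fun i hi j hj => ?_
    simpa only [zero_add, hK'] using digitWalk_sub_sq_le hq hN (hK ▸ hi) (hK ▸ hj) x
  have hmean := expect_le_expect fun x (_ : x ∈ range (q ^ (4 * (K + K) + 4))) => hcompare x
  rw [hwalk, expect_add_distrib, ← mul_expect, expect_add_distrib, expect_const hrange,
    ← mul_expect] at hmean
  have hjumps := mul_le_mul_of_nonneg_left (expect_waveJumps_le hq K)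
    (by positivity : 0 ≤ 4 * (K : ℝ) ^ 2 * K)
  rw [sub_mul, add_div, mul_div_assoc (4 * (K : ℝ) ^ 2)]
  linarith

theorem meanBlockVar_sub_mul_sum_le_sum_blockVar_squareMean (hq : Even q) (hq₀ : 0 < q)
    {m n : ℕ} (hm : 0 < m) (hK : m ^ n = K) {N : ℕ → ℕ+}
    (hN : ∀ j, (N j : ℕ) = waveTime q K j) :
    (meanBlockVar (q ^ 4) m n - (32 * K ^ 2 + 4 * K ^ 2 * (K + 1)) / q) *
        ∑ x ∈ range (q ^ (4 * (K + K) + 4)), ‖(waveModel q K x : ℂ)‖ ^ 2 ≤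
      ∑ x ∈ range (q ^ (4 * (K + K) + 4)), blockVar m n
        (fun j => squareMean Nat.succ (fun y => (waveModel q K y : ℂ)) (N j) x) 0 := by
  rw [sum_norm_waveModel_sq hq hq₀, ← card_mul_expect, card_range, mul_left_comm]
  gcongr
  exact meanBlockVar_sub_mul_le_expect_blockVar_squareMean hq₀ hm hK hN

theorem exists_periodic_le_sum_blockVar_squareMean (C : ℝ) :
    ∃ (m n R : ℕ) (F : ℕ → ℂ) (N : ℕ → ℕ+), 0 < m ∧ StrictMono N ∧
      (∀ j ≤ m ^ n, (N j : ℕ) ^ 2 ≤ 2 ^ R) ∧ Function.Periodic F (2 ^ R) ∧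
      0 < ∑ x ∈ range (2 ^ R), ‖F x‖ ^ 2 ∧
      C * ∑ x ∈ range (2 ^ R), ‖F x‖ ^ 2 ≤
        ∑ x ∈ range (2 ^ R), blockVar m n (fun j => squareMean Nat.succ F (N j) x) 0 := by
  obtain ⟨m, n, hm, hmean⟩ := exists_forall_even_le_meanBlockVar (C + 1)
  obtain ⟨K, hK⟩ : ∃ K, m ^ n = K := ⟨_, rfl⟩
  have hK₀ : 0 < K := hK ▸ pow_pos hm n
  obtain ⟨h, hh⟩ := pow_unbounded_of_one_lt (32 * K ^ 2 + 4 * K ^ 2 * (K + 1)) one_lt_two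
  have hh₀ : h ≠ 0 := by
    rintro rfl
    nlinarith [pow_zero 2]
  obtain ⟨q, hq⟩ : ∃ q, 2 ^ h = q := ⟨_, rfl⟩
  have hqeven : Even q := hq ▸ even_two.pow_of_ne_zero hh₀
  have hq₁ : 1 < q := hq ▸ Nat.one_lt_two_pow hh₀
  have hq₀ : 0 < q := by lia
  have herr : (32 * K ^ 2 + 4 * K ^ 2 * (K + 1) : ℝ) / q ≤ 1 := by
    rw [div_le_one (by positivity), ← hq]
    exact_mod_cast hh.le
  obtain ⟨N, hN⟩ : ∃ N : ℕ → ℕ+, ∀ j, (N j : ℕ) = waveTime q K j :=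
    ⟨fun j => ⟨_, pow_pos hq₀ _⟩, fun _ => rfl⟩
  refine ⟨m, n, h * (4 * (K + K) + 4), fun x => waveModel q K x, N, hm, fun i j hij => ?_, ?_⟩
  · rw [← PNat.coe_lt_coe, hN, hN]
    exact Nat.pow_lt_pow_right hq₁ (by lia)
  rw [pow_mul, hq, sum_norm_waveModel_sq hqeven hq₀]
  refine ⟨fun j hj => ?_, fun x => ?_, by positivity, ?_⟩
  · rw [hN, waveTime, ← pow_mul]
    exact Nat.pow_le_pow_right hq₀ (by lia)
  · simp only [periodic_waveModel hqeven hq₀ K x]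
  · rw [← sum_norm_waveModel_sq hqeven hq₀]
    refine le_trans ?_
      (meanBlockVar_sub_mul_sum_le_sum_blockVar_squareMean (n := n) hqeven hq₀ hm hK hN)
    gcongr
    linarith [hmean (q ^ 4) (hqeven.pow_of_ne_zero four_ne_zero) (by positivity)]

end Model

section Transference

variable {X : Type*} {T : X → X} {B : ℕ → Set X} {H H' : ℕ}

theorem rVariation_const_mul {r : ℝ} (hr : 0 < r) (c : ℂ) (a : ℕ+ → ℂ) :
    rVariation r (fun N => c * a N) = ‖c‖ₑ * rVariation r a := by
  have hroot (b : ℝ≥0∞) : (‖c‖ₑ ^ r * b) ^ (1 / r) = ‖c‖ₑ * b ^ (1 / r) := by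
    rw [ENNReal.mul_rpow_of_nonneg _ _ (one_div_nonneg.2 hr.le), ← ENNReal.rpow_mul,
      mul_one_div_cancel hr.ne', ENNReal.rpow_one]
  simp only [rVariation, ← mul_sub, enorm_mul, ENNReal.mul_rpow_of_nonneg _ _ hr.le,
    ENNReal.tsum_mul_left, hroot, ENNReal.mul_iSup]

/-- The function on `X` which is equal to `g i` on the level `B i` of a tower of height `H`, and to
`0` off the tower. -/
noncomputable def towerFun {A : Type*} [AddCommMonoid A] (B : ℕ → Set X) (H : ℕ) (g : ℕ → A)
    (x : X) : A :=
  ∑ i ∈ range H, (B i).indicator (fun _ => g i) x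

section towerFun

variable {A A' : Type*} [AddCommMonoid A] [AddCommMonoid A'] {x : X}

theorem towerFun_of_mem (hB : (range H : Set ℕ).PairwiseDisjoint B) (g : ℕ → A) {i : ℕ}
    (hi : i < H) (hx : x ∈ B i) : towerFun B H g x = g i := by
  rw [towerFun, sum_eq_single_of_mem i (mem_range.2 hi), Set.indicator_of_mem hx]
  intro j hj hji
  exact Set.indicator_of_notMem (fun hxj => hji (hB.elim_set hj (mem_range.2 hi) x hxj hx)) _

theorem towerFun_of_forall_notMem (g : ℕ → A) (hx : ∀ i < H, x ∉ B i) : towerFun B H g x = 0 :=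
  sum_eq_zero fun i hi => Set.indicator_of_notMem (hx i (mem_range.1 hi)) _

theorem map_towerFun (hB : (range H : Set ℕ).PairwiseDisjoint B) (g : ℕ → A) {φ : A → A'}
    (hφ : φ 0 = 0) (x : X) : φ (towerFun B H g x) = towerFun B H (fun i => φ (g i)) x := by
  by_cases hx : ∃ i < H, x ∈ B i
  · obtain ⟨i, hi, hxi⟩ := hx
    rw [towerFun_of_mem hB _ hi hxi, towerFun_of_mem hB _ hi hxi]
  · push Not at hx
    rw [towerFun_of_forall_notMem _ hx, towerFun_of_forall_notMem _ hx, hφ]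

end towerFun

theorem squareMean_towerFun (hB : (range H : Set ℕ).PairwiseDisjoint B) {F : ℕ → ℂ} {N : ℕ+}
    {i : ℕ} {x : X}
    (hx : ∀ l ≤ (N : ℕ) ^ 2, ∃ i' < H, T^[l] x ∈ B i' ∧ F i' = F (i + l)) :
    squareMean T (towerFun B H F) N x = squareMean Nat.succ F N i := by
  rw [squareMean, squareMean]
  refine congrArg _ (sum_congr rfl fun n hn => ?_)
  obtain ⟨i', hi', hmem, hF⟩ := hx _ (Nat.pow_le_pow_left (mem_Icc.1 hn).2 2)
  rw [towerFun_of_mem hB _ hi' hmem, hF, Nat.succ_iterate]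

theorem ofReal_blockVar_le_rVariation_towerFun_sq {m n : ℕ} (hm : 0 < m)
    (hB : (range H : Set ℕ).PairwiseDisjoint B) {F : ℕ → ℂ} {N : ℕ → ℕ+} (hN : StrictMono N)
    {L i : ℕ} (hL : ∀ j ≤ m ^ n, (N j : ℕ) ^ 2 ≤ L) {x : X}
    (hx : ∀ l ≤ L, ∃ i' < H, T^[l] x ∈ B i' ∧ F i' = F (i + l)) :
    ENNReal.ofReal (blockVar m n (fun j => squareMean Nat.succ F (N j) i) 0) ≤
      (rVariation 2 fun N => squareMean T (towerFun B H F) N x) ^ 2 := by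
  have hmean : ∀ j ≤ m ^ n,
      squareMean Nat.succ F (N j) i = squareMean T (towerFun B H F) (N j) x := fun j hj =>
    (squareMean_towerFun hB fun l hl => hx l (hl.trans (hL j hj))).symm
  refine le_of_eq_of_le ?_ (ofReal_blockVar_le_rVariation_sq hm n _ hN 0)
  congr 1
  exact blockVar_congr hm n fun p hp q hq => by simp only [zero_add, hmean p hp, hmean q hq]

variable [MeasurableSpace X] {μ : Measure X} {β : ℝ≥0∞}

theorem exists_eLpNorm_eq_one_of_mul_le {p : ℝ≥0∞} {r : ℝ} (hr : 0 < r) {C : ℝ≥0∞} {f : X → ℂ}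
    (hf : MemLp f p μ) (hf₀ : eLpNorm f p μ ≠ 0) (hC : C * eLpNorm f p μ ≤
      eLpNorm (fun x => rVariation r fun N => squareMean T f N x) p μ) :
    ∃ g : X → ℂ, MemLp g p μ ∧ eLpNorm g p μ = 1 ∧
      C ≤ eLpNorm (fun x => rVariation r fun N => squareMean T g N x) p μ := by
  obtain ⟨A, hA⟩ : ∃ A : ℝ≥0, (A : ℝ≥0∞) = eLpNorm f p μ :=
    ⟨_, ENNReal.coe_toNNReal hf.eLpNorm_ne_top⟩
  have hA₀ : (A : ℝ≥0∞) ≠ 0 := hA ▸ hf₀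
  have hA₁ : ((A : ℝ) : ℂ) ≠ 0 := by exact_mod_cast hA₀
  have henorm : ‖((A : ℝ) : ℂ)‖ₑ = A := by
    rw [← ofReal_norm, Complex.norm_of_nonneg A.coe_nonneg, ENNReal.ofReal_coe_nnreal]
  set g : X → ℂ := fun x => ((A : ℝ) : ℂ)⁻¹ * f x
  have hfg : f = fun x => ((A : ℝ) : ℂ) * g x :=
    funext fun x => (mul_inv_cancel_left₀ hA₁ (f x)).symm
  refine ⟨g, hf.const_mul _, ?_, ?_⟩
  · have := eLpNorm_const_smul ((A : ℝ) : ℂ)⁻¹ f p μ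
    rw [enorm_inv hA₁, henorm, ← hA, ENNReal.inv_mul_cancel hA₀ ENNReal.coe_ne_top] at this
    exact this
  · have hscale := eLpNorm_le_mul_eLpNorm_of_ae_le_mul' (μ := μ) (c := A) (p := p)
      (f := fun x => rVariation r fun N => squareMean T f N x)
      (g := fun x => rVariation r fun N => squareMean T g N x) (.of_forall fun x => by
        simp only [enorm_eq_self, hfg, squareMean_const_mul, rVariation_const_mul hr, henorm,
          le_refl])
    rw [← hA, mul_comm] at hC
    exact (ENNReal.mul_le_mul_iff_right hA₀ ENNReal.coe_ne_top).1 (hC.trans hscale)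

theorem eLpNorm_two_sq {ε : Type*} [TopologicalSpace ε] [ContinuousENorm ε] (f : X → ε) :
    eLpNorm f 2 μ ^ 2 = ∫⁻ x, ‖f x‖ₑ ^ 2 ∂μ := by
  simpa using eLpNorm_nnreal_pow_eq_lintegral (f := f) (μ := μ) (p := 2) two_ne_zero

theorem lintegral_towerFun (hBm : ∀ i < H, MeasurableSet (B i)) (hμ : ∀ i < H, μ (B i) = β)
    (g : ℕ → ℝ≥0∞) : ∫⁻ x, towerFun B H g x ∂μ = (∑ i ∈ range H, g i) * β := by
  simp only [towerFun]
  rw [lintegral_finsetSum _ fun i hi => measurable_const.indicator (hBm i (mem_range.1 hi)),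
    sum_mul]
  refine sum_congr rfl fun i hi => ?_
  rw [lintegral_indicator_const (hBm i (mem_range.1 hi)), hμ i (mem_range.1 hi)]

theorem sum_mul_le_lintegral_of_tower (hBm : ∀ i < H, MeasurableSet (B i))
    (hB : (range H : Set ℕ).PairwiseDisjoint B) (hμ : ∀ i < H, μ (B i) = β) {g : ℕ → ℝ≥0∞}
    {V : X → ℝ≥0∞} (hV : ∀ i < H, ∀ x ∈ B i, g i ≤ V x) :
    (∑ i ∈ range H, g i) * β ≤ ∫⁻ x, V x ∂μ := by
  rw [← lintegral_towerFun hBm hμ]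
  refine lintegral_mono fun x => ?_
  by_cases hx : ∃ i < H, x ∈ B i
  · obtain ⟨i, hi, hxi⟩ := hx
    exact (towerFun_of_mem hB g hi hxi).trans_le (hV i hi x hxi)
  · push Not at hx
    exact (towerFun_of_forall_notMem g hx).trans_le bot_le

theorem memLp_towerFun (hBm : ∀ i < H, MeasurableSet (B i)) (hμ : ∀ i < H, μ (B i) = β)
    (hβ : β ≠ ∞) (F : ℕ → ℂ) (p : ℝ≥0∞) : MemLp (towerFun B H F) p μ :=
  memLp_finsetSum _ fun i hi => memLp_indicator_const p (hBm i (mem_range.1 hi)) _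
    (Or.inr (hμ i (mem_range.1 hi) ▸ hβ))

theorem eLpNorm_towerFun_sq (hBm : ∀ i < H, MeasurableSet (B i))
    (hB : (range H : Set ℕ).PairwiseDisjoint B) (hμ : ∀ i < H, μ (B i) = β) (F : ℕ → ℂ) :
    eLpNorm (towerFun B H F) 2 μ ^ 2 = ENNReal.ofReal (∑ i ∈ range H, ‖F i‖ ^ 2) * β := by
  rw [eLpNorm_two_sq, lintegral_congr fun x => map_towerFun hB F (φ := fun z => ‖z‖ₑ ^ 2)
    (by simp) x, lintegral_towerFun hBm hμ, ENNReal.ofReal_sum_of_nonneg fun i _ => sq_nonneg _]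
  simp only [ENNReal.ofReal_pow (norm_nonneg _), ofReal_norm]

theorem exists_le_eLpNorm_rVariation_of_tower (hBm : ∀ i < H, MeasurableSet (B i))
    (hB : (range H : Set ℕ).PairwiseDisjoint B) (hμ : ∀ i < H, μ (B i) = β) (hβ₀ : β ≠ 0)
    (hβ : β ≠ ∞) (hH : H' ≤ H) {m n L : ℕ} (hm : 0 < m) {F : ℕ → ℂ} {N : ℕ → ℕ+}
    (hN : StrictMono N) (hL : ∀ j ≤ m ^ n, (N j : ℕ) ^ 2 ≤ L)
    (hT : ∀ i < H', ∀ x ∈ B i, ∀ l ≤ L, ∃ i' < H, T^[l] x ∈ B i' ∧ F i' = F (i + l))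
    (hF : 0 < ∑ i ∈ range H, ‖F i‖ ^ 2) {C : ℝ≥0}
    (hC : C ^ 2 * ∑ i ∈ range H, ‖F i‖ ^ 2 ≤
      ∑ i ∈ range H', blockVar m n (fun j => squareMean Nat.succ F (N j) i) 0) :
    ∃ f : X → ℂ, MemLp f 2 μ ∧ eLpNorm f 2 μ = 1 ∧
      C ≤ eLpNorm (fun x => rVariation 2 fun N => squareMean T f N x) 2 μ := by
  have hnorm := eLpNorm_towerFun_sq hBm hB hμ F
  refine exists_eLpNorm_eq_one_of_mul_le two_pos (memLp_towerFun hBm hμ hβ F 2) ?_ ?_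
  · rw [← pow_ne_zero_iff two_ne_zero, hnorm]
    exact mul_ne_zero (ENNReal.ofReal_pos.2 hF).ne' hβ₀
  rw [← ENNReal.pow_le_pow_left_iff two_ne_zero, mul_pow, hnorm, ← mul_assoc, eLpNorm_two_sq]
  calc (C : ℝ≥0∞) ^ 2 * ENNReal.ofReal (∑ i ∈ range H, ‖F i‖ ^ 2) * β
      = ENNReal.ofReal (C ^ 2 * ∑ i ∈ range H, ‖F i‖ ^ 2) * β := by
        rw [ENNReal.ofReal_mul (by positivity), ENNReal.ofReal_pow C.coe_nonneg,
          ENNReal.ofReal_coe_nnreal]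
    _ ≤ (∑ i ∈ range H', ENNReal.ofReal
          (blockVar m n (fun j => squareMean Nat.succ F (N j) i) 0)) * β := by
        rw [← ENNReal.ofReal_sum_of_nonneg fun i _ => blockVar_nonneg _ _ _ _]
        gcongr
    _ ≤ _ := sum_mul_le_lintegral_of_tower (fun i hi => hBm i (hi.trans_le hH))
        (hB.subset (by simpa using hH)) (fun i hi => hμ i (hi.trans_le hH)) fun i hi x hx => by
          rw [enorm_eq_self]
          exact ofReal_blockVar_le_rVariation_towerFun_sq hm hB hN hL (hT i hi x hx)

end Transference

theorem sum_range_mul_of_periodic {A : Type*} [AddCommMonoid A] {P : ℕ} {g : ℕ → A}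
    (hg : Function.Periodic g P) (c : ℕ) :
    ∑ x ∈ range (c * P), g x = c • ∑ x ∈ range P, g x := by
  induction c with
  | zero => simp
  | succ c ih =>
    have hshift (x : ℕ) : g (c * P + x) = g x := by rw [add_comm]; exact hg.nat_mul c x
    simp only [add_mul, one_mul, sum_range_add, hshift, ih, succ_nsmul]

theorem periodic_squareMean_succ {P : ℕ} {F : ℕ → ℂ} (hF : Function.Periodic F P) (N : ℕ+) :
    Function.Periodic (squareMean Nat.succ F N) P := fun x => by
  simp only [squareMean, Nat.succ_iterate, add_right_comm x P, hF _]

section Circle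

open Metric

theorem pairwiseDisjoint_closedBall_nsmul {p : ℝ} [Fact (0 < p)] {α : AddCircle p} {r : ℝ}
    (hr : addOrderOf α * (2 * r) < p) :
    (range (addOrderOf α) : Set ℕ).PairwiseDisjoint fun i => closedBall (i • α) r := by
  intro i hi j hj hij
  have hα : 0 < addOrderOf α := (mem_range.1 hi).bot_lt
  refine Set.disjoint_left.2 fun x hxi hxj => ?_
  set u := i • α - j • α
  have hu : addOrderOf α • u = 0 := by
    rw [nsmul_sub, nsmul_left_comm, nsmul_left_comm _ j, addOrderOf_nsmul_eq_zero, smul_zero,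
      smul_zero, sub_zero]
  have hu₀ : u ≠ 0 := fun h => hij <|
    nsmul_injOn_Iio_addOrderOf (mem_range.1 hi) (mem_range.1 hj) (sub_eq_zero.1 h)
  have hnorm : ‖u‖ ≤ 2 * r := by
    rw [two_mul, ← dist_eq_norm]
    exact (dist_triangle_left _ _ x).trans (add_le_add hxi hxj)
  have hp : p ≤ addOrderOf α * (2 * r) := by
    calc p ≤ addOrderOf u • ‖u‖ := AddCircle.le_add_order_smul_norm_of_isOfFinAddOrder
          (isOfFinAddOrder_iff_nsmul_eq_zero.2 ⟨_, hα, hu⟩) hu₀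
      _ ≤ addOrderOf α * (2 * r) := by
        rw [nsmul_eq_mul]
        gcongr
        exact Nat.le_of_dvd hα (addOrderOf_dvd_of_nsmul_eq_zero hu)
  exact hp.not_gt hr

theorem exists_le_eLpNorm_rVariation_add_const (C : ℝ≥0) : ∃ R₀ : ℕ, ∀ α : UnitAddCircle,
    0 < addOrderOf α → 2 ^ R₀ ∣ addOrderOf α →
      ∃ f : UnitAddCircle → ℂ, MemLp f 2 volume ∧ eLpNorm f 2 volume = 1 ∧
        C ≤ eLpNorm (fun x => rVariation 2 fun N => squareMean (· + α) f N x) 2 volume := by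
  obtain ⟨m, n, R, F, N, hm, hN, hNR, hF, hF₀, hC⟩ :=
    exists_periodic_le_sum_blockVar_squareMean (C ^ 2)
  refine ⟨R, fun α hα ⟨c, hc⟩ => ?_⟩
  set Q := addOrderOf α
  have hc₀ : 0 < c := Nat.pos_of_mul_pos_left (hc ▸ hα)
  have hQ : Q = c * 2 ^ R := hc.trans (mul_comm _ _)
  have hFQ : Function.Periodic F Q := hQ ▸ hF.nat_mul c
  have hsumF : ∑ x ∈ range (c * 2 ^ R), ‖F x‖ ^ 2 = c • ∑ x ∈ range (2 ^ R), ‖F x‖ ^ 2 :=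
    sum_range_mul_of_periodic (hF.comp fun z => ‖z‖ ^ 2) c
  have hsumU := sum_range_mul_of_periodic (P := 2 ^ R)
    (g := fun x => blockVar m n (fun j => squareMean Nat.succ F (N j) x) 0)
    (fun x => by simp only [periodic_squareMean_succ hF _ x]) c
  set r : ℝ := 1 / (4 * Q)
  have hr : 0 < r := by positivity
  have hQr : Q * (2 * r) < 1 := by
    rw [show Q * (2 * r) = 1 / 2 by simp only [r]; field_simp; norm_num]
    norm_num
  refine exists_le_eLpNorm_rVariation_of_tower (H := Q) (H' := Q) (F := F)
    (B := fun i => closedBall (i • α) r) (fun _ _ => measurableSet_closedBall)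
    (pairwiseDisjoint_closedBall_nsmul hQr) (fun _ _ => AddCircle.volume_closedBall 1 r)
    (by simp [hr]) ENNReal.ofReal_ne_top le_rfl hm hN hNR (fun i _ x hx l _ => ?_) ?_ ?_
  · refine ⟨(i + l) % Q, Nat.mod_lt _ hα, ?_, hFQ.map_mod_nat _⟩
    rw [add_right_iterate, mod_addOrderOf_nsmul, add_nsmul]
    simpa only [mem_closedBall, dist_add_right] using hx
  · rw [hQ, hsumF]
    exact nsmul_pos hF₀ hc₀.ne'
  · rw [hQ, hsumF, hsumU, mul_smul_comm]
    exact nsmul_le_nsmul_right hC c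

theorem addOrderOf_one_div_two_pow (R : ℕ) :
    addOrderOf ((1 / 2 ^ R : ℝ) : UnitAddCircle) = 2 ^ R := by
  exact_mod_cast AddCircle.addOrderOf_period_div (p := (1 : ℝ)) (Nat.two_pow_pos R)

end Circle

theorem pairwiseDisjoint_preimage_iterate {X : Type*} {T : X → X} {A : Set X} {H : ℕ}
    (hA : ∀ n, 0 < n → n ≤ H → Disjoint A (T^[n] ⁻¹' A)) :
    (Set.Iic H).PairwiseDisjoint fun i => T^[i] ⁻¹' A := by
  have hlt : ∀ i j, i < j → j ≤ H → Disjoint (T^[i] ⁻¹' A) (T^[j] ⁻¹' A) := fun i j hij hj => by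
    obtain ⟨n, rfl⟩ := Nat.exists_eq_add_of_lt hij
    have := (hA (n + 1) n.succ_pos (by omega)).preimage T^[i]
    rwa [← Set.preimage_comp, ← Function.iterate_add, add_right_comm, add_comm _ i] at this
  intro i hi j hj hij
  rcases hij.lt_or_gt with hij | hij
  · exact hlt i j hij hj
  · exact (hlt j i hij hi).symm

section Aperiodic

variable {X : Type*} [MeasurableSpace X] {μ : Measure X} {T : X → X}

theorem IsAperiodic.exists_subset_disjoint_preimage_iterate (hT : MeasurePreserving T μ μ)
    (h : IsAperiodic T μ) {E : Set X} (hE : MeasurableSet E) (hE₀ : μ E ≠ 0) (hE' : μ E ≠ ∞)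
    (H : ℕ) : ∃ A ⊆ E, MeasurableSet A ∧ μ A ≠ 0 ∧
      ∀ n, 0 < n → n ≤ H → Disjoint A (T^[n] ⁻¹' A) := by
  induction H with
  | zero => exact ⟨E, subset_rfl, hE, hE₀, fun n hn hn' => absurd hn' hn.not_ge⟩
  | succ H ih =>
    obtain ⟨A, hAE, hA, hA₀, hdisj⟩ := ih
    obtain ⟨F, hFA, hF, hF₀⟩ := h (H + 1) H.succ_pos A hA hA₀
    have hTn := hT.iterate (H + 1)
    refine ⟨F \ T^[H + 1] ⁻¹' F, (Set.sdiff_subset.trans hFA).trans hAE,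
      hF.diff (hTn.measurable hF), fun hdiff => hF₀ ?_, fun n hn hnH => ?_⟩
    · have hμF := hTn.measure_preimage hF.nullMeasurableSet
      have hF' : μ F ≠ ∞ := measure_ne_top_of_subset (hFA.trans hAE) hE'
      exact measure_symmDiff_eq_zero_iff.2 <| ae_eq_of_ae_subset_of_measure_ge
        (ae_le_set.2 hdiff) hμF.le hF.nullMeasurableSet (hμF ▸ hF')
    · rcases Nat.le_succ_iff.1 hnH with hnH | rfl
      · exact (hdisj n hn hnH).mono (Set.sdiff_subset.trans hFA)
          (Set.preimage_mono (Set.sdiff_subset.trans hFA))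
      · exact Set.disjoint_sdiff_left.mono_right (Set.preimage_mono Set.sdiff_subset)

theorem IsAperiodic.symm {τ : X ≃ᵐ X} (hτ : MeasurePreserving τ μ μ) (h : IsAperiodic τ μ) :
    IsAperiodic τ.symm μ := fun n hn E hE hE₀ => by
  obtain ⟨F, hFE, hF, hF₀⟩ := h n hn E hE hE₀
  refine ⟨F, hFE, hF, ?_⟩
  have hleft : Function.LeftInverse τ.symm^[n] τ^[n] :=
    Function.LeftInverse.iterate τ.symm_apply_apply n
  have hmeas : MeasurableSet (F ∆ (τ.symm^[n] ⁻¹' F)) :=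
    hF.symmDiff (τ.symm.measurable.iterate n hF)
  rwa [← (hτ.iterate n).measure_preimage hmeas.nullMeasurableSet, Set.preimage_symmDiff,
    ← Set.preimage_comp, hleft.comp_eq_id, Set.preimage_id, symmDiff_comm]

theorem IsAperiodic.exists_le_eLpNorm_rVariation [SigmaFinite μ] [NeZero μ]
    (hT : MeasurePreserving T μ μ) (h : IsAperiodic T μ) (C : ℝ≥0) :
    ∃ f : X → ℂ, MemLp f 2 μ ∧ eLpNorm f 2 μ = 1 ∧
      C ≤ eLpNorm (fun x => rVariation 2 fun N => squareMean T f N x) 2 μ := by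
  obtain ⟨m, n, R, F, N, hm, hN, hNR, hF, hF₀, hC⟩ :=
    exists_periodic_le_sum_blockVar_squareMean (2 * C ^ 2)
  have hsumF : ∑ x ∈ range (2 * 2 ^ R), ‖F x‖ ^ 2 = 2 * ∑ x ∈ range (2 ^ R), ‖F x‖ ^ 2 :=
    (sum_range_mul_of_periodic (hF.comp fun z => ‖z‖ ^ 2) 2).trans (nsmul_eq_mul 2 _)
  set P := 2 ^ R
  obtain ⟨E, hE, -, hE₀, hE'⟩ := Measure.exists_subset_measure_lt_top (μ := μ) MeasurableSet.univ
    (pos_iff_ne_zero.2 (Measure.measure_univ_ne_zero.2 (NeZero.ne μ)))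
  obtain ⟨A, hAE, hA, hA₀, hdisj⟩ :=
    h.exists_subset_disjoint_preimage_iterate hT hE hE₀.ne' hE'.ne (2 * P)
  refine exists_le_eLpNorm_rVariation_of_tower (H := 2 * P) (H' := P) (L := P) (F := F)
    (B := fun i => T^[2 * P - (i + 1)] ⁻¹' A) (fun i _ => hT.measurable.iterate _ hA) ?_
    (fun i _ => (hT.iterate _).measure_preimage hA.nullMeasurableSet) hA₀
    (measure_ne_top_of_subset hAE hE'.ne) (by omega) hm hN hNR
    (fun i hi x hx l hl => ⟨i + l, by omega, ?_, rfl⟩) ?_ ?_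
  · intro i hi j hj hij
    rw [mem_coe, mem_range] at hi hj
    exact pairwiseDisjoint_preimage_iterate hdisj (Set.mem_Iic.2 (by omega))
      (Set.mem_Iic.2 (by omega)) (by omega)
  · rw [Set.mem_preimage, ← Function.iterate_add_apply]
    rwa [show 2 * P - (i + l + 1) + l = 2 * P - (i + 1) by omega]
  · rw [hsumF]
    positivity
  · rwa [hsumF, ← mul_assoc, mul_comm _ 2]

end Aperiodic

theorem mainTheorem3_general :
    (∀ C : ℝ≥0, ∃ R₀ : ℕ, ∀ α : UnitAddCircle, 0 < addOrderOf α → 2 ^ R₀ ∣ addOrderOf α →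
      ∃ f : UnitAddCircle → ℂ, MemLp f 2 volume ∧ eLpNorm f 2 volume = 1 ∧
        C ≤ eLpNorm (fun x => rVariation 2 fun N => squareMean (· + α) f N x) 2 volume) ∧
    (∀ (X : Type*) [MeasurableSpace X] (μ : Measure X) [SigmaFinite μ] [NeZero μ] (T : X → X),
      MeasurePreserving T μ μ → IsAperiodic T μ →
      ∀ C : ℝ≥0,
        ∃ f : X → ℂ, MemLp f 2 μ ∧ eLpNorm f 2 μ = 1 ∧
          C ≤ eLpNorm (fun x => rVariation 2 fun N => squareMean T f N x) 2 μ) :=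
  ⟨exists_le_eLpNorm_rVariation_add_const,
    fun _ _ _ _ _ _ hT h => h.exists_le_eLpNorm_rVariation hT⟩

theorem mainTheorem3 :
    (∀ C : ℝ, 0 < C → ∃ R₀ : ℕ, ∀ R : ℕ, R₀ ≤ R →
      ∃ f : UnitAddCircle → ℂ, MemLp f 2 volume ∧ eLpNorm f 2 volume = 1 ∧
        ENNReal.ofReal C ≤ eLpNorm (fun x => rVariation 2 fun N =>
          squareMean (fun y => y + (((1 / 2 ^ R : ℝ)) : UnitAddCircle)) f N x) 2 volume) ∧
    (∀ (X : Type*) [MeasurableSpace X] (μ : Measure X) [IsProbabilityMeasure μ] (τ : X ≃ᵐ X),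
      MeasurePreserving τ μ μ → IsAperiodic τ μ →
      ∀ C : ℝ, 0 < C →
        ∃ f : X → ℂ, MemLp f 2 μ ∧ eLpNorm f 2 μ = 1 ∧
          ENNReal.ofReal C ≤ eLpNorm (fun x => rVariation 2 fun N =>
            squareMean τ.symm f N x) 2 μ) := by
  obtain ⟨hcircle, haperiodic⟩ := mainTheorem3_general
  exact ⟨fun C _ => (hcircle C.toNNReal).imp fun R₀ h R hR =>
      h _ (by rw [addOrderOf_one_div_two_pow]; positivity)
        (by rw [addOrderOf_one_div_two_pow]; exact pow_dvd_pow 2 hR),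
    fun X _ μ _ τ hτ h C _ => haperiodic X μ τ.symm hτ.symm (h.symm hτ) C.toNNReal⟩
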